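/- **Setting.** Let $\mathcal V$ be a countably infinite set of variables and $\mathcal P=\{0,1,2\}^{*}$ the set of positions, with prefix order $\le$. A *lambda tree* is a partial function $t:\mathcal P\rightharpoonup\{\lambda,@\}\uplus\mathcal P\uplus\mathcal V$ such that $p0\in\mathrm{dom}(t)$ implies $t(p)=\lambda$; $p1\in\mathrm{dom}(t)$ or $p2\in\mathrm{dom}(t)$ implies $t(p)=@$; and $t(p)=q\in\mathcal P$ implies $q\le p$ and $t(q)=\lambda$ (the label $q$ denotes a variable bound by the abstraction at $q$). The empty tree is $\bot$. A $\bot$-position of $t$ is $\langle\rangle$ if $t=\bot$, a position $p0\notin\mathrm{dom}(t)$ with $t(p)=\lambda$, or a position $pi\notin\mathrm{dom}(t)$ with $i\in\{1,2\}$ and $t(p)=@$; $t$ is *total* if it has none. Abstraction $\lambda x.t$, application $t_1\,t_2$, substitution $t[x:=s]$ and the subtree $t|_p$ are the usual operations on such trees, a fresh variable always being available for the opening of an abstraction; $t|_p$ is determined up to renaming of free variables, and all notions below are applied up to injective renaming of free variables. Fix a strictness signature $\bar a=a_0a_1a_2\in\{0,1\}^3$. The depth of $p=\langle i_1,\dots,i_n\rangle$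 is $|p|=a_{i_1}+\dots+a_{i_n}$. A position $q i$ is *strict* if $a_i=0$; all other positions, including $\langle\rangle$, are non-strict; $\hat p$ denotes the longest non-strict prefix of $p$. A lambda tree is *$\bar a$-guarded* if along each of its infinite branches the depth of positions is unbounded; $\mathcal T_\bot$ is the set of $\bar a$-guarded lambda trees. For $s\neq t$ let $d(s,t)=2^{-m}$ with $m$ the least $|p|$ such that $s$ and $t$ differ at $p$; $d(t,t)=0$. Let $s\le t$ on $\mathcal T_\bot$ mean that $\mathrm{dom}(s)\subseteq\mathrm{dom}(t)$, that $s$ and $t$ agree on $\mathrm{dom}(s)$, and that $p\in\mathrm{dom}(s)$, $a_i=0$, $pi\in\mathrm{dom}(t)$ imply $pi\in\mathrm{dom}(s)$. For a rewrite system $R$ (a relation on $\mathcal T_\bot$ whose left-hand sides are not $\bot$), $s\to_{R,p}t$ is the closure of $R$ under abstraction and application, where $p$ is the position of the contracted subtree. A reduction of ordinal length $\alpha$ is a sequence of steps $t_\iota\to_{R,p_\iota}t_{\iota+1}$, $\iota<\alpha$, in $\mathcal T_\bot$. It *$m$-converges* to $t_\alpha$ if for every limit ordinal $0<\gamma\le\alpha$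 we have $\lim_{\iota\to\gamma}t_\iota=t_\gamma$ in $(\mathcal T_\bot,d)$ and $|p_\iota|\to\infty$ as $\iota\to\gamma$. The reduction context $c_\iota$ of $t_\iota\to_{p_\iota}t_{\iota+1}$ is the greatest $c\in\mathcal T_\bot$ with $c\le t_\iota$, $c\le t_{\iota+1}$ and $p_\iota\notin\mathrm{dom}(c)$. The reduction is *$p$-continuous* if $t_\gamma=\liminf_{\iota\to\gamma}c_\iota=\bigsqcup_{\beta<\gamma}\bigsqcap_{\beta\le\iota<\gamma}c_\iota$ for every limit ordinal $0<\gamma<\alpha$. It is *destructive* if $\alpha>0$ is a limit ordinal, it is $p$-continuous, and for each $\beta<\alpha$ there is $\beta\le\gamma<\alpha$ with $\hat p_\gamma=\langle\rangle$. Let $\beta=\{((\lambda x.t)\,s,\;t[x:=s])\}$. A tree $t\in\mathcal T_\bot$ is *fragile* if a destructive $\beta$-reduction starts from it; $\mathcal F$ is the set of fragile total trees in $\mathcal T_\bot$. Let $\mathcal F_\bot$ be the set of lambda trees $t$ for which there is $s\in\mathcal F$ with $s(p)=t(p)$ for all $p\in\mathrm{dom}(t)$ and $s|_p\in\mathcal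 F$ for each $\bot$-position $p$ of $t$. The *Böhm rewrite system* of $\mathcal F$ is $$\mathcal B=\beta\cup\{(t,\bot): t\in\mathcal F_\bot,\ t\neq\bot\}.$$ **Theorem.** For every strictness signature $\bar a$ and every $\bar a$-guarded lambda tree $s\in\mathcal T_\bot$ there are a $\mathcal B$-normal form $t\in\mathcal T_\bot$ (no $\mathcal B$-step starts from $t$) and a $\mathcal B$-reduction from $s$ that $m$-converges to $t$. -/

import Mathlib

namespace InfLam

universe u

/-- Positions: finite sequences over `{0, 1, 2}`, read from the root. The prefix order is `<+:`. -/
abbrev Pos : Type := List (Fin 3)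

/-- A strictness signature `a₀a₁a₂`; `0` means strict, `1` means non-strict. -/
abbrev Sig : Type := Fin 3 → Fin 2

/-- The depth of a position: the number of its non-strict non-empty prefixes. -/
def depth (a : Sig) (p : Pos) : ℕ := (p.map fun i => (a i : ℕ)).sum

/-- The longest non-strict prefix of `p`. A position is strict if it has the form `q ++ [i]` with
`a i = 0`, so one removes the maximal block of trailing entries `i` with `a i = 0`. -/
def cut (a : Sig) (p : Pos) : Pos := p.rdropWhile fun i => decide (a i = 0)

/-- Labels: abstraction, application, a variable bound by the abstraction at position `q`, and a
free variable. -/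
inductive Label (V : Type u) : Type u
  | lam : Label V
  | app : Label V
  | bvar (q : Pos) : Label V
  | fvar (x : V) : Label V

/-- Lambda trees with free variables in `V`, as partial functions from positions to labels. -/
@[ext]
structure LTree (V : Type u) : Type u where
  label : Pos → Option (Label V)
  lam_of_child : ∀ p : Pos, label (p ++ [0]) ≠ none → label p = some Label.lam
  app_of_child : ∀ (p : Pos) (i : Fin 3), i ≠ 0 → label (p ++ [i]) ≠ none →
    label p = some Label.app
  binder : ∀ p q : Pos, label p = some (Label.bvar q) → q <+: p ∧ label q = some Label.lam

/-- Put the prefix `p` in front of the binding positions. -/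
def Label.shift {V : Type u} (p : Pos) : Label V → Label V
  | .lam => .lam
  | .app => .app
  | .bvar q => .bvar (p ++ q)
  | .fvar x => .fvar x

/-- The relabelling of the body of an abstraction that binds the variable `none`. -/
def Label.close {V : Type u} : Label (Option V) → Label V
  | .lam => .lam
  | .app => .app
  | .bvar q => .bvar (0 :: q)
  | .fvar none => .bvar []
  | .fvar (some x) => .fvar x

/-- Remove the variable `none`, which is to be substituted for. -/
def Label.strip {V : Type u} : Label (Option V) → Option (Label V)
  | .lam => some .lam
  | .app => some .app
  | .bvar q => some (.bvar q)
  | .fvar none => none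
  | .fvar (some x) => some (.fvar x)

open Classical in
/-- The relabelling of the subtree at `p`: a variable whose binder `r` lies outside of the subtree
becomes the free variable `Sum.inr r`. -/
noncomputable def Label.cutAt {V : Type u} (p : Pos) : Label V → Label (V ⊕ Pos)
  | .lam => .lam
  | .app => .app
  | .bvar r => if p <+: r then .bvar (r.drop p.length) else .fvar (Sum.inr r)
  | .fvar x => .fvar (Sum.inl x)

section Facts
variable {V : Type u}

theorem Label.shift_eq_lam {p : Pos} {l : Label V} : l.shift p = .lam ↔ l = .lam := by
  cases l <;> simp [Label.shift]

theorem Label.shift_eq_app {p : Pos} {l : Label V} : l.shift p = .app ↔ l = .app := by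
  cases l <;> simp [Label.shift]

theorem Label.shift_eq_bvar {p q : Pos} {l : Label V} :
    l.shift p = .bvar q ↔ ∃ r, l = .bvar r ∧ q = p ++ r := by
  cases l <;> simp [Label.shift, eq_comm]

theorem Label.close_eq_lam {l : Label (Option V)} : l.close = .lam ↔ l = .lam := by
  rcases l with _ | _ | q | (_ | x) <;> simp [Label.close]

theorem Label.close_eq_app {l : Label (Option V)} : l.close = .app ↔ l = .app := by
  rcases l with _ | _ | q | (_ | x) <;> simp [Label.close]

theorem Label.close_eq_bvar {q : Pos} {l : Label (Option V)} :
    l.close = .bvar q ↔ (l = .fvar none ∧ q = []) ∨ ∃ r, l = .bvar r ∧ q = 0 :: r := by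
  rcases l with _ | _ | q | (_ | x) <;> simp [Label.close, eq_comm]

theorem Label.strip_eq_bvar {q : Pos} {l : Label (Option V)} :
    l.strip = some (.bvar q) ↔ l = .bvar q := by
  rcases l with _ | _ | q | (_ | x) <;> simp [Label.strip]

theorem Label.cutAt_eq_bvar {p q : Pos} {l : Label V} :
    l.cutAt p = .bvar q ↔ l = .bvar (p ++ q) := by
  rcases l with _ | _ | r | x
  · simp [Label.cutAt]
  · simp [Label.cutAt]
  · simp only [Label.cutAt, Label.bvar.injEq]
    split_ifs with h
    · obtain ⟨r, rfl⟩ := h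
      simp
    · simp only [false_iff]
      rintro rfl
      exact h (List.prefix_append _ _)
  · simp [Label.cutAt]

/-- A proper prefix of a position in the domain is labelled by abstraction or application. -/
theorem LTree.inner (t : LTree V) {p q : Pos} (hq : q ≠ []) (h : t.label (p ++ q) ≠ none) :
    t.label p = some .lam ∨ t.label p = some .app := by
  induction q using List.reverseRecOn with
  | nil => exact absurd rfl hq
  | append_singleton q i ih =>
    rw [← List.append_assoc] at h
    have key : t.label (p ++ q) = some .lam ∨ t.label (p ++ q) = some .app := by
      by_cases hi : i = 0
      · subst hi
        exact Or.inl (t.lam_of_child _ h)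
      · exact Or.inr (t.app_of_child _ i hi h)
    by_cases hq' : q = []
    · simpa [hq'] using key
    · refine ih hq' ?_
      rcases key with h' | h' <;> simp [h']

/-- A position has at most one prefix labelled by a given free variable. -/
theorem LTree.fvar_unique (t : LTree V) {x : V} {p₁ p₂ q₁ q₂ : Pos} (h : p₁ ++ p₂ = q₁ ++ q₂)
    (hp : t.label p₁ = some (.fvar x)) (hq : t.label q₁ = some (.fvar x)) :
    p₁ = q₁ ∧ p₂ = q₂ := by
  rcases List.append_eq_append_iff.1 h with ⟨r, h1, h2⟩ | ⟨r, h1, h2⟩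
  · by_cases hr : r = []
    · subst hr; simp_all
    · have := t.inner (p := p₁) hr (by rw [← h1, hq]; simp)
      simp [hp] at this
  · by_cases hr : r = []
    · subst hr; simp_all
    · have := t.inner (p := q₁) hr (by rw [← h1, hp]; simp)
      simp [hq] at this

end Facts

namespace LTree

variable {V : Type u}

/-- The domain of a lambda tree. -/
def dom (t : LTree V) : Set Pos := {p | t.label p ≠ none}

/-- The empty lambda tree `⊥`. -/
def bot (V : Type u) : LTree V where
  label _ := none
  lam_of_child := by simp
  app_of_child := by simp
  binder := by simp

/-- The lambda tree that consists of the free variable `x`. -/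
def var (x : V) : LTree V where
  label p := match p with
    | [] => some (.fvar x)
    | _ :: _ => none
  lam_of_child := by rintro (_ | ⟨i, p⟩) <;> simp
  app_of_child := by rintro (_ | ⟨i, p⟩) <;> simp
  binder := by rintro (_ | ⟨i, p⟩) <;> simp

/-- The labelling of an abstraction. -/
def absLabel (t : LTree (Option V)) : Pos → Option (Label V)
  | [] => some .lam
  | i :: p => if i = 0 then (t.label p).map Label.close else none

/-- The abstraction `λx.t`. The bound variable `x` is the additional variable `none` of the body,
hence distinct from all variables in `V`. -/
def abs (t : LTree (Option V)) : LTree V where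
  label := absLabel t
  lam_of_child := by
    rintro (_ | ⟨i, p⟩)
    · simp [absLabel]
    · by_cases hi : i = 0
      · simpa [absLabel, hi, Label.close_eq_lam] using t.lam_of_child p
      · simp [absLabel, hi]
  app_of_child := by
    rintro (_ | ⟨i, p⟩) j hj
    · simp [absLabel, hj]
    · by_cases hi : i = 0
      · simpa [absLabel, hi, Label.close_eq_app] using t.app_of_child p j hj
      · simp [absLabel, hi]
  binder := by
    rintro (_ | ⟨i, p⟩) q
    · simp [absLabel]
    · by_cases hi : i = 0
      · subst hi
        simp only [absLabel, if_true, Option.map_eq_some_iff, Label.close_eq_bvar]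
        rintro ⟨l, hl, ⟨rfl, rfl⟩ | ⟨r, rfl, rfl⟩⟩
        · simp
        · obtain ⟨h1, h2⟩ := t.binder _ _ hl
          exact ⟨by simpa using h1, by simp [h2, Label.close]⟩
      · simp [absLabel, hi]

/-- The labelling of an application. -/
def appLabel (t₁ t₂ : LTree V) : Pos → Option (Label V)
  | [] => some .app
  | i :: p => if i = 1 then (t₁.label p).map (Label.shift [1])
    else if i = 2 then (t₂.label p).map (Label.shift [2]) else none

/-- The application of `t₁` to `t₂`. -/
def app (t₁ t₂ : LTree V) : LTree V where
  label := appLabel t₁ t₂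
  lam_of_child := by
    rintro (_ | ⟨i, p⟩)
    · simp [appLabel]
    · by_cases h1 : i = 1
      · simpa [appLabel, h1, Label.shift_eq_lam] using t₁.lam_of_child p
      · by_cases h2 : i = 2
        · simpa [appLabel, h2, Label.shift_eq_lam] using t₂.lam_of_child p
        · simp [appLabel, h1, h2]
  app_of_child := by
    rintro (_ | ⟨i, p⟩) j hj
    · simp [appLabel]
    · by_cases h1 : i = 1
      · simpa [appLabel, h1, Label.shift_eq_app] using t₁.app_of_child p j hj
      · by_cases h2 : i = 2
        · simpa [appLabel, h2, Label.shift_eq_app] using t₂.app_of_child p j hj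
        · simp [appLabel, h1, h2]
  binder := by
    rintro (_ | ⟨i, p⟩) q
    · simp [appLabel]
    · by_cases h1 : i = 1
      · subst h1
        simp only [appLabel, if_true, Option.map_eq_some_iff, Label.shift_eq_bvar]
        rintro ⟨l, hl, r, rfl, rfl⟩
        obtain ⟨h1, h2⟩ := t₁.binder _ _ hl
        exact ⟨by simpa using h1, by simp [h2, Label.shift]⟩
      · by_cases h2 : i = 2
        · subst h2
          simp only [appLabel, h1, if_true, if_false, Option.map_eq_some_iff, Label.shift_eq_bvar]
          rintro ⟨l, hl, r, rfl, rfl⟩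
          obtain ⟨h1, h2⟩ := t₂.binder _ _ hl
          exact ⟨by simpa using h1, by simp [h2, Label.shift]⟩
        · simp [appLabel, h1, h2]

open Classical in
/-- The labelling of the substitution of `s` for the variable `none` in `t`: if `p = p₁ ++ p₂` where
`t` has the variable `none` at `p₁`, take the label of `s` at `p₂`, with binding positions moved
below `p₁`; otherwise take the label of `t` at `p`. -/
noncomputable def substLabel (t : LTree (Option V)) (s : LTree V) (p : Pos) : Option (Label V) :=
  if h : ∃ d : Pos × Pos, p = d.1 ++ d.2 ∧ t.label d.1 = some (.fvar none) then
    (s.label h.choose.2).map (Label.shift h.choose.1)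
  else (t.label p).bind Label.strip

theorem substLabel_inside (t : LTree (Option V)) (s : LTree V) {p₁ : Pos} (p₂ : Pos)
    (h : t.label p₁ = some (.fvar none)) :
    substLabel t s (p₁ ++ p₂) = (s.label p₂).map (Label.shift p₁) := by
  have hex : ∃ d : Pos × Pos, p₁ ++ p₂ = d.1 ++ d.2 ∧ t.label d.1 = some (.fvar none) :=
    ⟨(p₁, p₂), rfl, h⟩
  obtain ⟨h1, h2⟩ := t.fvar_unique hex.choose_spec.1 h hex.choose_spec.2
  rw [substLabel, dif_pos hex, ← h1, ← h2]

theorem substLabel_outside (t : LTree (Option V)) (s : LTree V) {p : Pos}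
    (h : ∀ p₁, p₁ <+: p → t.label p₁ ≠ some (.fvar none)) :
    substLabel t s p = (t.label p).bind Label.strip := by
  rw [substLabel, dif_neg]
  rintro ⟨⟨p₁, p₂⟩, hp, h1⟩
  exact h p₁ ⟨p₂, hp.symm⟩ h1

theorem substLabel_of_inner (t : LTree (Option V)) (s : LTree V) {p : Pos} {l : Label (Option V)}
    (hl : l = .lam ∨ l = .app ∨ ∃ q, l = .bvar q) (h : t.label p = some l) :
    substLabel t s p = l.strip := by
  rw [substLabel_outside, h]
  · rfl
  · rintro p₁ ⟨p₂, rfl⟩ h1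
    by_cases h2 : p₂ = []
    · subst h2
      rw [List.append_nil, h1] at h
      rcases hl with rfl | rfl | ⟨q, rfl⟩ <;> simp at h
    · have := t.inner (p := p₁) h2 (by rw [h]; simp)
      simp [h1] at this

/-- The step from a child to its parent in a substitution. -/
theorem substLabel_child (t : LTree (Option V)) (s : LTree V) (p : Pos) (i : Fin 3)
    (h : substLabel t s (p ++ [i]) ≠ none) :
    (∃ p₁ p₂, p = p₁ ++ p₂ ∧ t.label p₁ = some (.fvar none) ∧ s.label (p₂ ++ [i]) ≠ none) ∨
      t.label (p ++ [i]) ≠ none := by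
  by_cases hex : ∃ p₁, p₁ <+: p ++ [i] ∧ t.label p₁ = some (.fvar none)
  · obtain ⟨p₁, ⟨p₂, hp⟩, h1⟩ := hex
    rcases List.eq_nil_or_concat p₂ with rfl | ⟨r, j, rfl⟩
    · right
      rw [← hp, List.append_nil, h1]
      simp
    · left
      rw [List.concat_eq_append, ← List.append_assoc] at hp
      obtain ⟨rfl, hj⟩ := List.append_inj' hp rfl
      obtain rfl : j = i := by simpa using hj
      refine ⟨p₁, r, rfl, h1, ?_⟩
      rw [List.append_assoc, substLabel_inside t s _ h1] at h
      intro h0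
      simp [h0] at h
  · right
    push Not at hex
    rw [substLabel_outside t s hex] at h
    intro h0
    simp [h0] at h

/-- The substitution `t[x := s]`, where `x` is the variable `none` of `t`. -/
noncomputable def subst (t : LTree (Option V)) (s : LTree V) : LTree V where
  label := substLabel t s
  lam_of_child := by
    intro p h
    rcases substLabel_child t s p 0 h with ⟨p₁, p₂, rfl, h1, h2⟩ | h'
    · rw [substLabel_inside t s _ h1, s.lam_of_child _ h2]
      rfl
    · rw [substLabel_of_inner t s (Or.inl rfl) (t.lam_of_child _ h')]
      rfl
  app_of_child := by
    intro p i hi h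
    rcases substLabel_child t s p i h with ⟨p₁, p₂, rfl, h1, h2⟩ | h'
    · rw [substLabel_inside t s _ h1, s.app_of_child _ i hi h2]
      rfl
    · rw [substLabel_of_inner t s (Or.inr (Or.inl rfl)) (t.app_of_child _ i hi h')]
      rfl
  binder := by
    intro p q h
    by_cases hex : ∃ p₁, p₁ <+: p ∧ t.label p₁ = some (.fvar none)
    · obtain ⟨p₁, ⟨p₂, rfl⟩, h1⟩ := hex
      rw [substLabel_inside t s _ h1] at h
      simp only [Option.map_eq_some_iff, Label.shift_eq_bvar] at h
      obtain ⟨l, hl, r, rfl, rfl⟩ := h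
      obtain ⟨h2, h3⟩ := s.binder _ _ hl
      refine ⟨(List.prefix_append_right_inj p₁).2 h2, ?_⟩
      rw [substLabel_inside t s _ h1, h3]
      rfl
    · push Not at hex
      rw [substLabel_outside t s hex] at h
      simp only [Option.bind_eq_some_iff, Label.strip_eq_bvar] at h
      obtain ⟨l, hl, rfl⟩ := h
      obtain ⟨h2, h3⟩ := t.binder _ _ hl
      refine ⟨h2, ?_⟩
      rw [substLabel_of_inner t s (Or.inl rfl) h3]
      rfl

/-- The subtree of `t` at `p`. The variables bound in `t` by an abstraction above `p` become free;
the one bound at `r` is named `Sum.inr r`. The free variables `x` of `t` are named `Sum.inl x`. -/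
noncomputable def subtree (t : LTree V) (p : Pos) : LTree (V ⊕ Pos) where
  label q := (t.label (p ++ q)).map (Label.cutAt p)
  lam_of_child := by
    intro q h
    have h' : t.label ((p ++ q) ++ [0]) ≠ none := by simpa using h
    rw [t.lam_of_child _ h']
    rfl
  app_of_child := by
    intro q i hi h
    have h' : t.label ((p ++ q) ++ [i]) ≠ none := by simpa using h
    rw [t.app_of_child _ i hi h']
    rfl
  binder := by
    intro q r h
    simp only [Option.map_eq_some_iff, Label.cutAt_eq_bvar] at h
    obtain ⟨l, hl, rfl⟩ := h
    obtain ⟨h1, h2⟩ := t.binder _ _ hl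
    refine ⟨(List.prefix_append_right_inj p).1 h1, ?_⟩
    rw [h2]
    rfl

/-- The `⊥`-positions of a lambda tree. -/
inductive BotPos (t : LTree V) : Pos → Prop
  | root : t.label [] = none → BotPos t []
  | lam (p : Pos) : t.label p = some .lam → t.label (p ++ [0]) = none → BotPos t (p ++ [0])
  | app (p : Pos) (i : Fin 3) : i = 1 ∨ i = 2 → t.label p = some .app →
      t.label (p ++ [i]) = none → BotPos t (p ++ [i])

/-- A lambda tree is total if it has no `⊥`-positions. -/
def Total (t : LTree V) : Prop := ∀ p, ¬ t.BotPos p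

/-- The prefix of length `n` of an infinite sequence. -/
def pref (b : ℕ → Fin 3) (n : ℕ) : Pos := (List.range n).map b

/-- `b` is an infinite branch of `t`. -/
def IsInfBranch (t : LTree V) (b : ℕ → Fin 3) : Prop := ∀ n, pref b n ∈ t.dom

/-- `t` is guarded if along none of its infinite branches the depth is bounded. -/
def Guarded (a : Sig) (t : LTree V) : Prop :=
  ∀ b, t.IsInfBranch b → ¬ ∃ n, ∀ k, depth a (pref b k) < n

open Classical in
/-- The distance of two lambda trees: `0` if they are equal, and otherwise `2 ^ (-d)` where `d` is
the least depth of a position at which they differ. -/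
noncomputable def treeDist (a : Sig) (s t : LTree V) : ℝ :=
  if s = t then 0 else (1 / 2 : ℝ) ^ sInf {d | ∃ p, d = depth a p ∧ s.label p ≠ t.label p}

end LTree

/-- The guarded lambda trees over `V`. -/
def GTree (a : Sig) (V : Type u) : Type u := {t : LTree V // t.Guarded a}

/-- The partial order on guarded lambda trees: holes may be filled, except for strict positions. -/
instance GTree.instPartialOrder (a : Sig) (V : Type u) : PartialOrder (GTree a V) where
  le s t := s.1.dom ⊆ t.1.dom ∧ (∀ p ∈ s.1.dom, s.1.label p = t.1.label p) ∧
    ∀ (p : Pos) (i : Fin 3), a i = 0 → p ++ [i] ∈ t.1.dom → p ∈ s.1.dom → p ++ [i] ∈ s.1.dom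
  le_refl s := ⟨subset_rfl, fun _ _ => rfl, fun _ _ _ h _ => h⟩
  le_trans s t w hst htw := ⟨hst.1.trans htw.1,
    fun p hp => (hst.2.1 p hp).trans (htw.2.1 p (hst.1 hp)),
    fun p i hi hw hs => hst.2.2 p i hi (htw.2.2 p i hi hw (hst.1 hs)) hs⟩
  le_antisymm s t hst hts := by
    apply Subtype.ext
    apply LTree.ext
    funext p
    by_cases hp : p ∈ s.1.dom
    · exact hst.2.1 p hp
    · have hs : s.1.label p = none := not_not.1 hp
      have ht : t.1.label p = none := not_not.1 fun h => hp (hts.1 h)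
      rw [hs, ht]

/-- Sets of lambda trees and rewrite systems are given uniformly in the set of free variables,
so that they apply to the body of an abstraction, which has one free variable more. -/
abbrev TreeSet : Type (u + 1) := ∀ V : Type u, Set (LTree V)

/-- See `TreeSet`. -/
abbrev RewriteSystem : Type (u + 1) := ∀ V : Type u, LTree V → LTree V → Prop

/-- `Step R p s t`: there is an `R`-reduction step from `s` to `t` at `p`. -/
def Step (R : RewriteSystem.{u}) : Pos → ∀ {V : Type u}, LTree V → LTree V → Prop
  | [], V, s, t => R V s t
  | i :: p, V, s, t =>
    (i = 0 ∧ ∃ r r' : LTree (Option V), s = r.abs ∧ t = r'.abs ∧ Step R p r r') ∨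
    (i = 1 ∧ ∃ r r' w : LTree V, s = r.app w ∧ t = r'.app w ∧ Step R p r r') ∨
    (i = 2 ∧ ∃ r r' w : LTree V, s = w.app r ∧ t = w.app r' ∧ Step R p r r')

/-- `t` is an `R`-normal form: no step between guarded lambda trees starts from `t`. -/
def IsNormalForm (a : Sig) (R : RewriteSystem.{u}) {V : Type u} (t : GTree a V) : Prop :=
  ¬ ∃ (p : Pos) (t' : GTree a V), Step R p t.1 t'.1

/-- The `β`-rule `(λx.t) s → t[x := s]`. -/
def betaRule : RewriteSystem.{u} := fun V l r =>
  ∃ (t : LTree (Option V)) (s : LTree V), l = (t.abs).app s ∧ r = t.subst s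

/-- `tr ι → tr (ι + 1)` at position `pos ι`, for `ι < α`, is an `R`-reduction of length `α`; values
of `tr` at indices greater than `α` and of `pos` at indices from `α` on are irrelevant. -/
def IsReduction {a : Sig} (R : RewriteSystem.{u}) {V : Type u} (α : Ordinal.{0})
    (tr : Ordinal.{0} → GTree a V) (pos : Ordinal.{0} → Pos) : Prop :=
  ∀ ι < α, Step R (pos ι) (tr ι).1 (tr (Order.succ ι)).1

/-- The lambda trees `tr ι`, `ι < γ`, converge to `t` in the metric space of guarded lambda trees. -/
def HasLimit {a : Sig} {V : Type u} (γ : Ordinal.{0}) (tr : Ordinal.{0} → GTree a V)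
    (t : GTree a V) : Prop :=
  ∀ ε : ℝ, 0 < ε → ∃ β < γ, ∀ ι, β ≤ ι → ι < γ → LTree.treeDist a (tr ι).1 t.1 < ε

/-- The reduction of length `α` strongly `m`-converges to `tr α`. -/
def MConverges {a : Sig} (R : RewriteSystem.{u}) {V : Type u} (α : Ordinal.{0})
    (tr : Ordinal.{0} → GTree a V) (pos : Ordinal.{0} → Pos) : Prop :=
  IsReduction R α tr pos ∧
    ∀ γ ≤ α, Order.IsSuccLimit γ → HasLimit γ tr (tr γ) ∧
      ∀ d : ℕ, ∃ β < γ, ∀ ι, β ≤ ι → ι < γ → d ≤ depth a (pos ι)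

/-- `c` is the reduction context of a step from `s` to `t` at `p`. -/
def IsRedContext {a : Sig} {V : Type u} (p : Pos) (s t c : GTree a V) : Prop :=
  IsGreatest {c : GTree a V | c ≤ s ∧ c ≤ t ∧ p ∉ c.1.dom} c

/-- `t` is the limit inferior of `c ι`, `ι < γ`, i.e. the least upper bound over `β < γ` of the
greatest lower bound of the `c ι` with `β ≤ ι < γ`. -/
def IsLiminf {a : Sig} {V : Type u} (γ : Ordinal.{0}) (c : Ordinal.{0} → GTree a V)
    (t : GTree a V) : Prop :=
  IsLUB {g | ∃ β < γ, IsGLB (c '' Set.Ico β γ) g} t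

/-- The reduction of length `α` is strongly `p`-continuous. -/
def PContinuous {a : Sig} (R : RewriteSystem.{u}) {V : Type u} (α : Ordinal.{0})
    (tr : Ordinal.{0} → GTree a V) (pos : Ordinal.{0} → Pos) : Prop :=
  IsReduction R α tr pos ∧ ∃ c : Ordinal.{0} → GTree a V,
    (∀ ι < α, IsRedContext (pos ι) (tr ι) (tr (Order.succ ι)) (c ι)) ∧
    ∀ γ < α, Order.IsSuccLimit γ → IsLiminf γ c (tr γ)

/-- The position `p` is volatile in an open reduction of length `α` that contracts at `pos`. -/
def Volatile (a : Sig) (α : Ordinal.{0}) (pos : Ordinal.{0} → Pos) (p : Pos) : Prop :=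
  ∀ β < α, ∃ γ, β ≤ γ ∧ γ < α ∧ cut a (pos γ) <+: p ∧ p <+: pos γ

/-- The reduction is destructive: open, `p`-continuous, and volatile at the root. -/
def Destructive {a : Sig} (R : RewriteSystem.{u}) {V : Type u} (α : Ordinal.{0})
    (tr : Ordinal.{0} → GTree a V) (pos : Ordinal.{0} → Pos) : Prop :=
  Order.IsSuccLimit α ∧ PContinuous R α tr pos ∧ Volatile a α pos []

/-- A guarded lambda tree is fragile if a destructive `β`-reduction starts from it. -/
def Fragile {a : Sig} {V : Type u} (t : GTree a V) : Prop :=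
  ∃ (α : Ordinal.{0}) (tr : Ordinal.{0} → GTree a V) (pos : Ordinal.{0} → Pos),
    tr 0 = t ∧ Destructive betaRule α tr pos

/-- The fragile total guarded lambda trees. -/
def fragileTotal (a : Sig) : TreeSet.{u} := fun V =>
  {t | t.Total ∧ ∃ t' : GTree a V, t'.1 = t ∧ Fragile t'}

/-- `s` is obtained from `t` by inserting elements of `U` at all `⊥`-positions of `t`. -/
def IsBotInstance (U : TreeSet.{u}) {V : Type u} (t s : LTree V) : Prop :=
  s.Total ∧ (∀ p ∈ t.dom, s.label p = t.label p) ∧ ∀ p, t.BotPos p → s.subtree p ∈ U (V ⊕ Pos)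

/-- The lambda trees that have a `⊥`-instance with respect to `U` that is in `U`. -/
def botClosure (U : TreeSet.{u}) : TreeSet.{u} := fun V =>
  {t | ∃ s, IsBotInstance U t s ∧ s ∈ U V}

/-- The rules `t → ⊥` for `t ≠ ⊥` in the `⊥`-closure of `U`. -/
def botRule (U : TreeSet.{u}) : RewriteSystem.{u} := fun V l r =>
  l ∈ botClosure U V ∧ l ≠ LTree.bot V ∧ r = LTree.bot V

/-- The Böhm rewrite system of `U`: the `β`-rule and the rules `t → ⊥`. -/
def bohmSystem (U : TreeSet.{u}) : RewriteSystem.{u} := fun V l r =>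
  betaRule V l r ∨ botRule U V l r

end InfLam

namespace InfLam

universe u

/-! The normal form is the limit of trees `f 0 = s`, `f 1`, `f 2`, ..., where `f n` is stable up to
depth `n`: no reduct of it admits a step at depth less than `n`. The reduction from `f n` to `f (n +
1)` therefore contracts only at depth at least `n`, so the whole concatenation converges strongly.
Its limit is a reduct of every `f n` and hence admits no step at any depth.

The heart is the first stage, `exists_red_stable_one`: each tree `t` reduces to one that is stable
up to depth 1. Suppose not. Then `t` does not reduce to `⊥`, since `⊥` admits no step. Let `fill r`
be `r` with the looping term `Ω = (λx. x x)(λx. x x)` at its `⊥`-positions. If `fill r` were fragile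
for a reduct `r` of `t`, then it would witness `r ∈ F_⊥`, and `r → ⊥` would be a step; so no such
`fill r` is fragile. A `⊥`-step at depth 0 would create a `⊥`-position at depth 0, where `fill`
places `Ω`, which loops there forever and makes the filled tree fragile. Hence every step at depth 0
reachable from `t` is a `β`-step, and as no reduct is stable, there is an infinite succession of
them. Forgetting the `⊥`-steps, this is simulated by a `β`-reduction from `fill t`, because
`β`-steps lift to trees with more subtrees (`Step.exists_of_sub`, `Red.exists_beta_of_sub`). The
simulating reduction contracts at depth 0 cofinally often, so it is destructive (`fragile_of_chain`)
and `fill t` is fragile, a contradiction.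

For the later stages (`Stable.exists_red_succ`), the root of a tree that is stable up to depth 1 is
never contracted, so reductions act independently on the immediate subtrees. A non-strict child
reduces the depth to be treated; a strict child does not, but guardedness bounds the length of the
positions of depth 0 (`Guarded.exists_bound`, by König's lemma), and this bound decreases.

Reductions are handled through the inductive predicate `Red`, closed under limits of `ω`-sequences,
and turned into reductions of ordinal length only at the end and in the construction of destructive
reductions (`exists_isConcat`, `Red.exists_realises`). There, strong convergence yields the limit
inferior of the reduction contexts that `p`-continuity asks for (`ConvergesAt.isLiminf`). -/

theorem depth_append (a : Sig) (p q : Pos) : depth a (p ++ q) = depth a p + depth a q := by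
  simp [depth]

theorem depth_cons (a : Sig) (i : Fin 3) (p : Pos) : depth a (i :: p) = (a i : ℕ) + depth a p := by
  simp [depth]

theorem depth_nil (a : Sig) : depth a [] = 0 := rfl

theorem depth_mono (a : Sig) {p q : Pos} (h : p <+: q) : depth a p ≤ depth a q := by
  obtain ⟨r, rfl⟩ := h
  rw [depth_append]
  exact Nat.le_add_right _ _

/-! ### Decomposition of a tree at its root. -/

namespace LTree

variable {V : Type u}

theorem label_ne_none_of_prefix (t : LTree V) {p q : Pos} (h : p <+: q) (hq : t.label q ≠ none) :
    t.label p ≠ none := by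
  obtain ⟨r, rfl⟩ := h
  by_cases hr : r = []
  · simpa [hr] using hq
  · rcases t.inner hr hq with h | h <;> simp [h]

theorem label_append_eq_none (t : LTree V) {p q : Pos} (hp : t.label p = none) :
    t.label (p ++ q) = none := by
  by_contra h
  exact t.label_ne_none_of_prefix (List.prefix_append p q) h hp

/-- The tree of which `u`, with an abstraction at the root, is the abstraction. -/
theorem exists_abs (u : LTree V) (h : u.label [] = some .lam) : ∃ r, u = abs r := by
  -- The inverse of `Label.close`: variables bound at the root become the fresh variable `none`.
  let op : Label V → Label (Option V) := fun l => match l with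
    | .lam => .lam
    | .app => .app
    | .bvar [] => .fvar none
    | .bvar (_ :: q) => .bvar q
    | .fvar x => .fvar (some x)
  have op_lam : ∀ l, op l = .lam ↔ l = .lam := by rintro (_ | _ | (_ | _) | _) <;> simp [op]
  have op_app : ∀ l, op l = .app ↔ l = .app := by rintro (_ | _ | (_ | _) | _) <;> simp [op]
  refine ⟨⟨fun p => (u.label (0 :: p)).map op, ?_, ?_, ?_⟩, ?_⟩
  · intro p hp
    rw [u.lam_of_child (0 :: p) (by simpa using hp)]
    rfl
  · intro p i hi hp
    rw [u.app_of_child (0 :: p) i hi (by simpa using hp)]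
    rfl
  · intro p q hp
    simp only [Option.map_eq_some_iff] at hp
    obtain ⟨l, hl, hq⟩ := hp
    obtain ⟨i, rfl⟩ : ∃ i, l = .bvar (i :: q) := by
      rcases l with _ | _ | (_ | ⟨i, q'⟩) | x <;> simp_all [op]
    obtain ⟨h1, h2⟩ := u.binder _ _ hl
    obtain ⟨rfl, h3⟩ := List.cons_prefix_cons.1 h1
    exact ⟨h3, by simp [h2, op]⟩
  · ext1
    funext p
    rcases p with _ | ⟨i, p⟩
    · simp [abs, absLabel, h]
    · by_cases hi : i = 0
      · subst hi
        simp only [abs, absLabel, if_true]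
        rcases hl : u.label (0 :: p) with _ | l
        · simp
        · rcases l with _ | _ | (_ | ⟨i, q'⟩) | x <;> simp [op, Label.close]
          obtain ⟨h1, h2⟩ := u.binder _ _ hl
          exact (List.cons_prefix_cons.1 h1).1
      · simp only [abs, absLabel, hi, if_false]
        by_contra hc
        have := u.app_of_child [] i hi (u.label_ne_none_of_prefix (q := i :: p) (by simp) hc)
        simp [h] at this

/-- The child at position `i` of an application. -/
theorem exists_child (u : LTree V) (h : u.label [] = some .app) (i : Fin 3) :
    ∃ r : LTree V, ∀ p, u.label (i :: p) = (r.label p).map (Label.shift [i]) := by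
  let op : Label V → Label V := fun l => match l with
    | .bvar q => .bvar q.tail
    | l => l
  have op_lam : ∀ l, op l = .lam ↔ l = .lam := by rintro (_ | _ | (_ | _) | _) <;> simp [op]
  have op_app : ∀ l, op l = .app ↔ l = .app := by rintro (_ | _ | (_ | _) | _) <;> simp [op]
  -- The root is an application and binds nothing, so all binders lie inside the child.
  have key : ∀ p q, u.label (i :: p) = some (.bvar q) → ∃ r, q = i :: r := by
    intro p q hl
    obtain ⟨h1, h2⟩ := u.binder _ _ hl
    rcases q with _ | ⟨j, q⟩
    · simp [h] at h2
    · obtain ⟨rfl, h1⟩ := List.cons_prefix_cons.1 h1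
      exact ⟨q, rfl⟩
  refine ⟨⟨fun p => (u.label (i :: p)).map op, ?_, ?_, ?_⟩, ?_⟩
  · intro p hp
    rw [u.lam_of_child (i :: p) (by simpa using hp)]
    rfl
  · intro p j hj hp
    rw [u.app_of_child (i :: p) j hj (by simpa using hp)]
    rfl
  · intro p q hp
    simp only [Option.map_eq_some_iff] at hp
    obtain ⟨l, hl, hq⟩ := hp
    rcases l with _ | _ | q' | x <;> simp only [op, Label.bvar.injEq, reduceCtorEq] at hq
    obtain ⟨r, rfl⟩ := key _ _ hl
    obtain rfl : r = q := hq
    obtain ⟨h1, h2⟩ := u.binder _ _ hl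
    exact ⟨(List.cons_prefix_cons.1 h1).2, by simp [h2, op]⟩
  · intro p
    rcases hl : u.label (i :: p) with _ | l
    · simp [hl]
    · rcases l with _ | _ | q | x <;> simp [hl, op, Label.shift]
      obtain ⟨r, rfl⟩ := key _ _ hl
      rfl

theorem exists_app (u : LTree V) (h : u.label [] = some .app) : ∃ r w, u = app r w := by
  obtain ⟨r, hr⟩ := u.exists_child h 1
  obtain ⟨w, hw⟩ := u.exists_child h 2
  refine ⟨r, w, ?_⟩
  ext1
  funext p
  rcases p with _ | ⟨i, p⟩
  · simp [app, appLabel, h]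
  · fin_cases i
    · simp only [app, appLabel]
      by_contra hc
      have := u.lam_of_child [] (u.label_ne_none_of_prefix (q := 0 :: p) (by simp) (by simpa using hc))
      simp [h] at this
    · simpa [app, appLabel] using hr p
    · simpa [app, appLabel] using hw p

theorem eq_bot_of_label (u : LTree V) (h : u.label [] = none) : u = bot V := by
  ext1
  funext p
  exact u.label_append_eq_none (q := p) h

theorem eq_var_of_label (u : LTree V) {x : V} (h : u.label [] = some (.fvar x)) : u = var x := by
  ext1
  funext p
  rcases p with _ | ⟨i, p⟩
  · exact h
  · by_contra hc
    have := u.inner (p := []) (q := i :: p) (by simp) (by simpa [var] using hc)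
    simp [h] at this

theorem cases_root (u : LTree V) :
    u = bot V ∨ (∃ x, u = var x) ∨ (∃ r, u = abs r) ∨ ∃ r w, u = app r w := by
  rcases h : u.label [] with _ | (_ | _ | q | x)
  · exact .inl (u.eq_bot_of_label h)
  · exact .inr (.inr (.inl (u.exists_abs h)))
  · exact .inr (.inr (.inr (u.exists_app h)))
  · obtain ⟨h1, h2⟩ := u.binder _ _ h
    obtain rfl := List.prefix_nil.1 h1
    simp [h] at h2
  · exact .inr (.inl ⟨x, u.eq_var_of_label h⟩)

theorem abs_label_cons (r : LTree (Option V)) (p : Pos) :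
    (abs r).label (0 :: p) = (r.label p).map Label.close := by simp [abs, absLabel]

theorem abs_label_cons_ne (r : LTree (Option V)) {i : Fin 3} (hi : i ≠ 0) (p : Pos) :
    (abs r).label (i :: p) = none := by simp [abs, absLabel, hi]

theorem app_label_cons_one (r w : LTree V) (p : Pos) :
    (app r w).label (1 :: p) = (r.label p).map (Label.shift [1]) := by simp [app, appLabel]

theorem app_label_cons_two (r w : LTree V) (p : Pos) :
    (app r w).label (2 :: p) = (w.label p).map (Label.shift [2]) := by simp [app, appLabel]

theorem app_label_cons_zero (r w : LTree V) (p : Pos) :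
    (app r w).label (0 :: p) = none := by simp [app, appLabel]

theorem abs_label_nil (r : LTree (Option V)) : (abs r).label [] = some .lam := rfl

theorem app_label_nil (r w : LTree V) : (app r w).label [] = some .app := rfl

end LTree

/-! ### Injectivity of the relabellings and of the constructors. -/

theorem Label.shift_injective {V : Type u} (p : Pos) :
    Function.Injective (Label.shift p : Label V → Label V) := by
  intro l m h
  cases l <;> cases m <;> simp_all [Label.shift]

theorem Label.close_injective {V : Type u} :
    Function.Injective (Label.close : Label (Option V) → Label V) := by
  intro l m h
  rcases l with _ | _ | _ | (_ | _) <;> rcases m with _ | _ | _ | (_ | _) <;>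
    simp_all [Label.close]

theorem Label.shift_shift {V : Type u} (p q : Pos) (l : Label V) :
    (l.shift q).shift p = l.shift (p ++ q) := by
  cases l <;> simp [Label.shift]

theorem map_inj_iff {α β : Type*} {f : α → β} (hf : Function.Injective f) {x y : Option α} :
    x.map f = y.map f ↔ x = y :=
  (Option.map_injective hf).eq_iff

namespace LTree

variable {V : Type u}

theorem abs_injective : Function.Injective (abs : LTree (Option V) → LTree V) := by
  intro r s h
  ext1
  funext p
  have := congrArg (fun t => t.label (0 :: p)) h
  simpa only [abs_label_cons, map_inj_iff Label.close_injective] using this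

theorem app_inj {r r' w w' : LTree V} : app r w = app r' w' ↔ r = r' ∧ w = w' := by
  refine ⟨fun h => ⟨?_, ?_⟩, by rintro ⟨rfl, rfl⟩; rfl⟩ <;> ext1 <;> funext p
  · have := congrArg (fun t => t.label (1 :: p)) h
    simpa only [app_label_cons_one, map_inj_iff (Label.shift_injective _)] using this
  · have := congrArg (fun t => t.label (2 :: p)) h
    simpa only [app_label_cons_two, map_inj_iff (Label.shift_injective _)] using this

theorem abs_ne_app (r : LTree (Option V)) (s w : LTree V) : abs r ≠ app s w := fun h => by
  have := congrArg (fun t => t.label []) h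
  simp [abs_label_nil, app_label_nil] at this

theorem abs_ne_bot (r : LTree (Option V)) : abs r ≠ bot V := fun h => by
  have := congrArg (fun t => t.label []) h
  simp [abs_label_nil, bot] at this

theorem app_ne_bot (r w : LTree V) : app r w ≠ bot V := fun h => by
  have := congrArg (fun t => t.label []) h
  simp [app_label_nil, bot] at this

theorem abs_ne_var (r : LTree (Option V)) (x : V) : abs r ≠ var x := fun h => by
  have := congrArg (fun t => t.label []) h
  simp [abs_label_nil, var] at this

theorem app_ne_var (r w : LTree V) (x : V) : app r w ≠ var x := fun h => by
  have := congrArg (fun t => t.label []) h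
  simp [app_label_nil, var] at this

/-! ### Branches and guardedness -/

theorem pref_succ (b : ℕ → Fin 3) (n : ℕ) : pref b (n + 1) = pref b n ++ [b n] := by
  simp [pref, List.range_succ]

theorem pref_add (b : ℕ → Fin 3) (n k : ℕ) :
    pref b (n + k) = pref b n ++ pref (fun i => b (n + i)) k := by
  induction k with
  | zero => simp [pref]
  | succ k ih => rw [← add_assoc, pref_succ, ih, pref_succ, List.append_assoc]

theorem pref_one_add (b : ℕ → Fin 3) (k : ℕ) :
    pref b (k + 1) = b 0 :: pref (fun i => b (i + 1)) k := by
  rw [add_comm, pref_add]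
  simp [pref, add_comm]

theorem length_pref (b : ℕ → Fin 3) (n : ℕ) : (pref b n).length = n := by simp [pref]

theorem prefix_pref {b : ℕ → Fin 3} {n : ℕ} {p : Pos} (h : p <+: pref b n) :
    p = pref b p.length := by
  have hl : p.length ≤ n := by simpa [length_pref] using h.length_le
  obtain ⟨k, rfl⟩ := Nat.exists_eq_add_of_le hl
  rw [pref_add] at h
  have := List.prefix_append (pref b p.length) (pref (fun i => b (p.length + i)) k)
  exact (List.prefix_of_prefix_length_le h this (by simp [length_pref])).eq_of_length
    (by simp [length_pref])

/-- Depth is additive, so the finite initial part of a branch has no influence on whether its depth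
is bounded. This transfers guardedness from a subtree to the tree around it. -/
theorem Guarded.of_tail {a : Sig} {t : LTree V} (ht : t.Guarded a) {b : ℕ → Fin 3} (n : ℕ)
    (hb : ∀ k, t.label (pref (fun i => b (n + i)) k) ≠ none) :
    ¬ ∃ m, ∀ k, depth a (pref b k) < m := by
  rintro ⟨m, hm⟩
  refine ht _ hb ⟨m, fun k => ?_⟩
  have := hm (n + k)
  rw [pref_add, depth_append] at this
  omega

theorem guarded_bot (a : Sig) : (bot V).Guarded a := fun _ hb => absurd rfl (hb 0)

theorem guarded_var (a : Sig) (x : V) : (var x).Guarded a := fun b hb =>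
  absurd (by rw [pref_one_add]; rfl) (hb 1)

theorem guarded_abs {a : Sig} {r : LTree (Option V)} : (abs r).Guarded a ↔ r.Guarded a := by
  constructor
  · intro h b hb
    have hb' : (abs r).IsInfBranch (fun n => n.casesOn 0 b) := by
      rintro (_ | n)
      · simp [pref, dom, abs_label_nil]
      · have := hb n
        simp only [pref_one_add, dom, Set.mem_ofPred_eq] at this ⊢
        simpa [abs_label_cons] using this
    rintro ⟨m, hm⟩
    refine h _ hb' ⟨(a 0 : ℕ) + m + 1, ?_⟩
    rintro (_ | k)
    · simp [pref, depth_nil]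
    · have := hm k
      rw [pref_one_add, depth_cons]
      change (a 0 : ℕ) + depth a (pref b k) < _
      omega
  · intro h b hb
    refine h.of_tail 1 fun k => ?_
    have := hb (k + 1)
    simp only [pref_one_add, dom, Set.mem_ofPred_eq] at this
    by_cases h0 : b 0 = 0
    · simp only [h0, abs_label_cons] at this
      simpa [add_comm] using this
    · simp [abs_label_cons_ne _ h0] at this

theorem guarded_app {a : Sig} {r w : LTree V} :
    (app r w).Guarded a ↔ r.Guarded a ∧ w.Guarded a := by
  constructor
  · intro h
    have key : ∀ (i : Fin 3) (s : LTree V),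
        (∀ p, (app r w).label (i :: p) = (s.label p).map (Label.shift [i])) → s.Guarded a := by
      intro i s hs b hb
      have hb' : (app r w).IsInfBranch (fun n => n.casesOn i b) := by
        rintro (_ | n)
        · simp [pref, dom, app_label_nil]
        · have := hb n
          simp only [pref_one_add, dom, Set.mem_ofPred_eq] at this ⊢
          simpa [hs] using this
      rintro ⟨m, hm⟩
      refine h _ hb' ⟨(a i : ℕ) + m + 1, ?_⟩
      rintro (_ | k)
      · simp [pref, depth_nil]
      · have := hm k
        rw [pref_one_add, depth_cons]
        change (a i : ℕ) + depth a (pref b k) < _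
        omega
    exact ⟨key 1 r (app_label_cons_one r w), key 2 w (app_label_cons_two r w)⟩
  · rintro ⟨hr, hw⟩ b hb
    have hk : ∀ k, (app r w).label (b 0 :: pref (fun i => b (1 + i)) k) ≠ none := by
      intro k
      have := hb (k + 1)
      simpa only [pref_one_add, dom, Set.mem_ofPred_eq, add_comm] using this
    generalize hi : b 0 = i at hk
    fin_cases i
    · exact absurd (app_label_cons_zero _ _ _) (hk 0)
    · exact hr.of_tail 1 fun k hn => hk k ((app_label_cons_one r w _).trans (by rw [hn]; rfl))
    · exact hw.of_tail 1 fun k hn => hk k ((app_label_cons_two r w _).trans (by rw [hn]; rfl))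

/-- An infinite branch either passes through an occurrence of the variable, and then a tail of it
runs in `s`, or it stays in `t` throughout. -/
theorem guarded_subst {a : Sig} {t : LTree (Option V)} {s : LTree V} (ht : t.Guarded a)
    (hs : s.Guarded a) : (subst t s).Guarded a := by
  intro b hb
  by_cases h : ∃ n, t.label (pref b n) = some (.fvar none)
  · obtain ⟨n, hn⟩ := h
    refine hs.of_tail n fun k hk => ?_
    have := hb (n + k)
    rw [pref_add] at this
    exact this (by simp [subst, substLabel_inside t s _ hn, hk])
  · push Not at h
    refine ht b fun n hn => hb n ?_
    change substLabel t s _ = none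
    rw [substLabel_outside, hn]
    · rfl
    · intro p hp
      rw [prefix_pref hp]
      exact h _

/-- In a guarded tree the positions of depth zero have bounded length. -/
theorem Guarded.exists_bound {a : Sig} {t : LTree V} (ht : t.Guarded a) :
    ∃ n, ∀ p, t.label p ≠ none → depth a p = 0 → p.length < n := by
  by_contra hcon
  push Not at hcon
  -- König's lemma: `Big p` says that `p` has arbitrarily long extensions of depth zero. As there
  -- are only three children, one child of a big position is big, which gives an infinite branch of
  -- depth zero.
  let Big : Pos → Prop := fun p =>
    ∀ n, ∃ q, t.label (p ++ q) ≠ none ∧ depth a (p ++ q) = 0 ∧ n ≤ q.length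
  have h0 : Big [] := by simpa [Big] using hcon
  have hs : ∀ p : {p // Big p}, ∃ i, Big (p.1 ++ [i]) := by
    rintro ⟨p, hp⟩
    by_contra hc
    simp only [Big, not_exists, not_forall, not_and, not_le] at hc
    choose N hN using hc
    -- The sum dominates each `N i`, and the additional 1 accounts for the first entry of `q`.
    obtain ⟨q, hq1, hq2, hq3⟩ := hp (N 0 + N 1 + N 2 + 1)
    rcases q with _ | ⟨i, q⟩
    · simp at hq3
    · have h := hN i q (by simpa using hq1) (by simpa using hq2)
      have hi : N i ≤ N 0 + N 1 + N 2 := by fin_cases i <;> simp <;> omega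
      simp only [List.length_cons] at hq3
      omega
  choose g hg using hs
  let P : ℕ → {p // Big p} := fun n => n.rec ⟨[], h0⟩ fun _ p => ⟨p.1 ++ [g p], hg p⟩
  have hP : ∀ n, pref (fun n => g (P n)) n = (P n).1 := by
    intro n
    induction n with
    | zero => rfl
    | succ n ih => rw [pref_succ, ih]
  refine ht (fun n => g (P n)) (fun n => ?_) ⟨1, fun n => ?_⟩
  · obtain ⟨q, hq, -⟩ := (P n).2 0
    rw [hP]
    exact t.label_ne_none_of_prefix (List.prefix_append _ _) hq
  · obtain ⟨q, -, hq, -⟩ := (P n).2 0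
    rw [hP]
    have := depth_mono a (List.prefix_append (P n).1 q)
    omega

/-! ### Totality -/

theorem total_iff {t : LTree V} : t.Total ↔ t.label [] ≠ none ∧
    (∀ p, t.label p = some .lam → t.label (p ++ [0]) ≠ none) ∧
    ∀ (p : Pos) (i : Fin 3), i = 1 ∨ i = 2 → t.label p = some .app → t.label (p ++ [i]) ≠ none := by
  constructor
  · exact fun h => ⟨fun h1 => h _ (.root h1), fun p h1 h2 => h _ (.lam p h1 h2),
      fun p i hi h1 h2 => h _ (.app p i hi h1 h2)⟩
  · rintro ⟨h1, h2, h3⟩ p hp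
    cases hp with
    | root h => exact h1 h
    | lam p h h' => exact h2 p h h'
    | app p i hi h h' => exact h3 p i hi h h'

theorem BotPos.label {t : LTree V} {p : Pos} (h : t.BotPos p) : t.label p = none := by
  cases h <;> assumption

theorem botPos_abs {r : LTree (Option V)} {p : Pos} (h : r.BotPos p) :
    (abs r).BotPos (0 :: p) := by
  cases h with
  | root h => exact .lam [] rfl (by simpa [abs_label_cons] using h)
  | lam p h h' =>
    exact .lam (0 :: p) (by simp [abs_label_cons, h, Label.close])
      (by simpa [abs_label_cons] using h')
  | app p i hi h h' =>
    exact .app (0 :: p) i hi (by simp [abs_label_cons, h, Label.close])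
      (by simpa [abs_label_cons] using h')

theorem botPos_child {t r : LTree V} {i : Fin 3} (hi : i = 1 ∨ i = 2) {p : Pos}
    (hr : ∀ p, t.label (i :: p) = (r.label p).map (Label.shift [i]))
    (ht : t.label [] = some .app) (h : r.BotPos p) : t.BotPos (i :: p) := by
  cases h with
  | root h => exact .app [] i hi ht (by simpa [hr] using h)
  | lam p h h' => exact .lam (i :: p) (by simp [hr, h, Label.shift]) (by simpa [hr] using h')
  | app p j hj h h' => exact .app (i :: p) j hj (by simp [hr, h, Label.shift]) (by simpa [hr] using h')

/-- Each inner node of the result stems either from `t` or from a copy of `s`, and its children are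
present there. -/
theorem total_subst {t : LTree (Option V)} {s : LTree V} (ht : t.Total) (hs : s.Total) :
    (subst t s).Total := by
  rw [total_iff] at ht hs
  have key : ∀ p, t.label p ≠ none → substLabel t s p ≠ none := by
    intro p hp
    by_cases h : ∃ p₁, p₁ <+: p ∧ t.label p₁ = some (.fvar none)
    · obtain ⟨p₁, ⟨p₂, rfl⟩, h1⟩ := h
      have : p₂ = [] := by
        by_contra h2
        have := t.inner h2 hp
        simp [h1] at this
      subst this
      rw [substLabel_inside t s _ h1]
      simpa using hs.1
    · push Not at h
      rw [substLabel_outside t s h]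
      obtain ⟨l, hl⟩ := Option.ne_none_iff_exists'.1 hp
      have := h p (List.prefix_refl p)
      rw [hl] at this ⊢
      rcases l with _ | _ | q | (_ | x) <;> simp_all [Label.strip]
  have inv : ∀ p l, substLabel t s p = some l → l = .lam ∨ l = .app →
      (∃ p₁ p₂, p = p₁ ++ p₂ ∧ t.label p₁ = some (.fvar none) ∧
        s.label p₂ = some l) ∨ (t.label p = some .lam ∧ l = .lam) ∨
        (t.label p = some .app ∧ l = .app) := by
    intro p l hl hl'
    by_cases h : ∃ p₁, p₁ <+: p ∧ t.label p₁ = some (.fvar none)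
    · obtain ⟨p₁, ⟨p₂, rfl⟩, h1⟩ := h
      rw [substLabel_inside t s _ h1] at hl
      refine .inl ⟨p₁, p₂, rfl, h1, ?_⟩
      rcases hl' with rfl | rfl <;>
        simpa [Label.shift_eq_lam, Label.shift_eq_app] using hl
    · push Not at h
      rw [substLabel_outside t s h] at hl
      rcases ht : t.label p with _ | (_ | _ | q | (_ | x)) <;> rcases hl' with rfl | rfl <;>
        simp_all [Label.strip]
  rw [total_iff]
  refine ⟨key [] ht.1, fun p hp => ?_, fun p i hi hp => ?_⟩
  · rcases inv p _ hp (.inl rfl) with ⟨p₁, p₂, rfl, h1, h2⟩ | ⟨h, -⟩ | ⟨-, h⟩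
    · have := hs.2.1 _ h2
      simpa [subst, substLabel_inside t s _ h1] using this
    · exact key _ (ht.2.1 _ h)
    · simp at h
  · rcases inv p _ hp (.inr rfl) with ⟨p₁, p₂, rfl, h1, h2⟩ | ⟨-, h⟩ | ⟨h, -⟩
    · have := hs.2.2 _ i hi h2
      simpa [subst, substLabel_inside t s _ h1] using this
    · simp at h
    · exact key _ (ht.2.2 _ i hi h)

/-! ### Inclusion of labellings -/

/-- `t` is obtained from `u` by removing subtrees. -/
def Sub (t u : LTree V) : Prop := ∀ p l, t.label p = some l → u.label p = some l

theorem Sub.refl (t : LTree V) : t.Sub t := fun _ _ h => h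

theorem Sub.trans {t u v : LTree V} (h : t.Sub u) (h' : u.Sub v) : t.Sub v :=
  fun p l hl => h' p l (h p l hl)

theorem sub_abs_iff {r r' : LTree (Option V)} : (abs r).Sub (abs r') ↔ r.Sub r' := by
  constructor
  · intro h p l hl
    have := h (0 :: p) l.close (by simp [abs_label_cons, hl])
    rw [abs_label_cons, ← Option.map_some, map_inj_iff Label.close_injective] at this
    exact this
  · rintro h (_ | ⟨i, p⟩) l hl
    · exact hl
    · by_cases hi : i = 0
      · subst hi
        rw [abs_label_cons, Option.map_eq_some_iff] at hl ⊢
        obtain ⟨m, hm, rfl⟩ := hl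
        exact ⟨m, h p m hm, rfl⟩
      · simp [abs_label_cons_ne _ hi] at hl

theorem sub_app_iff {r r' w w' : LTree V} :
    (app r w).Sub (app r' w') ↔ r.Sub r' ∧ w.Sub w' := by
  constructor
  · intro h
    refine ⟨fun p l hl => ?_, fun p l hl => ?_⟩
    · have := h (1 :: p) (l.shift [1]) (by simp [app_label_cons_one, hl])
      rw [app_label_cons_one, ← Option.map_some, map_inj_iff (Label.shift_injective _)] at this
      exact this
    · have := h (2 :: p) (l.shift [2]) (by simp [app_label_cons_two, hl])
      rw [app_label_cons_two, ← Option.map_some, map_inj_iff (Label.shift_injective _)] at this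
      exact this
  · rintro ⟨h1, h2⟩ (_ | ⟨i, p⟩) l hl
    · exact hl
    · fin_cases i
      · simp [app_label_cons_zero] at hl
      · simp only [Fin.mk_one, app_label_cons_one, Option.map_eq_some_iff] at hl ⊢
        obtain ⟨m, hm, rfl⟩ := hl
        exact ⟨m, h1 p m hm, rfl⟩
      · simp only [Fin.reduceFinMk, app_label_cons_two, Option.map_eq_some_iff] at hl ⊢
        obtain ⟨m, hm, rfl⟩ := hl
        exact ⟨m, h2 p m hm, rfl⟩

theorem exists_of_abs_sub {r : LTree (Option V)} {u : LTree V} (h : (abs r).Sub u) :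
    ∃ r', u = abs r' ∧ r.Sub r' := by
  obtain ⟨r', rfl⟩ := u.exists_abs (h [] _ rfl)
  exact ⟨r', rfl, sub_abs_iff.1 h⟩

theorem exists_of_app_sub {r w u : LTree V} (h : (app r w).Sub u) :
    ∃ r' w', u = app r' w' ∧ r.Sub r' ∧ w.Sub w' := by
  obtain ⟨r', w', rfl⟩ := u.exists_app (h [] _ rfl)
  exact ⟨r', w', rfl, sub_app_iff.1 h⟩

theorem substLabel_of_ne {t : LTree (Option V)} {s : LTree V} {p : Pos} {l : Label (Option V)}
    (h : t.label p = some l) (hl : l ≠ .fvar none) : substLabel t s p = l.strip := by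
  rw [substLabel_outside, h]
  · rfl
  · rintro p₁ ⟨p₂, rfl⟩ h1
    by_cases h2 : p₂ = []
    · subst h2
      simp_all
    · have := t.inner (p := p₁) h2 (by rw [h]; simp)
      simp [h1] at this

/-- Monotonicity of substitution is what lets a `β`-step be repeated in a tree with more subtrees.
-/
theorem Sub.subst {t t' : LTree (Option V)} {s s' : LTree V} (ht : t.Sub t') (hs : s.Sub s') :
    (subst t s).Sub (subst t' s') := by
  intro p l hl
  change substLabel t s p = _ at hl
  change substLabel t' s' p = _
  by_cases h : ∃ p₁, p₁ <+: p ∧ t.label p₁ = some (.fvar none)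
  · obtain ⟨p₁, ⟨p₂, rfl⟩, h1⟩ := h
    rw [substLabel_inside t s _ h1, Option.map_eq_some_iff] at hl
    obtain ⟨m, hm, rfl⟩ := hl
    rw [substLabel_inside t' s' _ (ht _ _ h1), hs _ _ hm]
    rfl
  · push Not at h
    rw [substLabel_outside t s h, Option.bind_eq_some_iff] at hl
    obtain ⟨m, hm, hl⟩ := hl
    have hne : m ≠ .fvar none := by
      rintro rfl
      simp [Label.strip] at hl
    rw [substLabel_of_ne (ht _ _ hm) hne, hl]

/-! ### A looping tree, and filling the holes of a tree with it -/

/-- The tree `λx. x x`. -/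
def selfApp (V : Type u) : LTree V := abs (app (var none) (var none))

/-- The tree `(λx. x x) (λx. x x)`. -/
def omega (V : Type u) : LTree V := app (selfApp V) (selfApp V)

theorem guarded_omega (a : Sig) : (omega V).Guarded a := by
  simp [omega, selfApp, guarded_app, guarded_abs, guarded_var]

theorem total_var (x : V) : (var x).Total := by
  rw [total_iff]
  refine ⟨by simp [var], ?_, ?_⟩
  · rintro (_ | ⟨i, p⟩) <;> simp [var]
  · rintro (_ | ⟨i, p⟩) <;> simp [var]

theorem total_abs {r : LTree (Option V)} (h : r.Total) : (abs r).Total := by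
  rw [total_iff] at h ⊢
  refine ⟨by simp [abs_label_nil], ?_, ?_⟩
  · rintro (_ | ⟨i, p⟩)
    · simpa [abs_label_cons] using fun _ => h.1
    · by_cases hi : i = 0
      · simpa [hi, abs_label_cons, Label.close_eq_lam] using h.2.1 p
      · simp [abs_label_cons_ne _ hi]
  · rintro (_ | ⟨i, p⟩) j hj
    · simp [abs_label_nil]
    · by_cases hi : i = 0
      · simpa [hi, abs_label_cons, Label.close_eq_app] using h.2.2 p j hj
      · simp [abs_label_cons_ne _ hi]

theorem total_app {r w : LTree V} (hr : r.Total) (hw : w.Total) : (app r w).Total := by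
  rw [total_iff] at hr hw ⊢
  refine ⟨by simp [app_label_nil], ?_, ?_⟩
  · rintro (_ | ⟨i, p⟩)
    · simp [app_label_nil]
    · fin_cases i
      · simp [app_label_cons_zero]
      · simpa [app_label_cons_one, Label.shift_eq_lam] using hr.2.1 p
      · simpa [app_label_cons_two, Label.shift_eq_lam] using hw.2.1 p
  · rintro (_ | ⟨i, p⟩) j hj
    · rcases hj with rfl | rfl
      · simpa [app_label_cons_one] using fun _ => hr.1
      · simpa [app_label_cons_two] using fun _ => hw.1
    · fin_cases i
      · simp [app_label_cons_zero]
      · simpa [app_label_cons_one, Label.shift_eq_app] using hr.2.2 p j hj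
      · simpa [app_label_cons_two, Label.shift_eq_app] using hw.2.2 p j hj

theorem total_omega : (omega V).Total :=
  have h := total_abs (total_app (total_var (none : Option V)) (total_var none))
  total_app h h

theorem selfApp_label {p : Pos} {l : Label V} (h : (selfApp V).label p = some l) :
    l = .lam ∨ l = .app ∨ l = .bvar [] := by
  rcases p with _ | ⟨i, _ | ⟨j, _ | ⟨k, p⟩⟩⟩
  · simp_all [selfApp, abs, absLabel]
  · fin_cases i <;> simp_all [selfApp, abs, absLabel, app, appLabel, Label.close]
  · fin_cases i <;> fin_cases j <;>
      simp_all [selfApp, abs, absLabel, app, appLabel, var, Label.close, Label.shift]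
  · fin_cases i <;> fin_cases j <;>
      simp_all [selfApp, abs, absLabel, app, appLabel, var]

theorem omega_label {p : Pos} {l : Label V} (h : (omega V).label p = some l) :
    l = .lam ∨ l = .app ∨ ∃ q, l = .bvar q := by
  rcases p with _ | ⟨i, p⟩
  · simp_all [omega, app_label_nil]
  · fin_cases i
    · simp [omega, app_label_cons_zero] at h
    · simp only [omega, Fin.mk_one, app_label_cons_one, Option.map_eq_some_iff] at h
      obtain ⟨m, hm, rfl⟩ := h
      rcases selfApp_label hm with rfl | rfl | rfl <;> simp [Label.shift]
    · simp only [omega, Fin.reduceFinMk, app_label_cons_two, Option.map_eq_some_iff] at h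
      obtain ⟨m, hm, rfl⟩ := h
      rcases selfApp_label hm with rfl | rfl | rfl <;> simp [Label.shift]

theorem betaRule_omega : betaRule V (omega V) (omega V) := by
  refine ⟨app (var none) (var none), selfApp V, rfl, ?_⟩
  ext1
  funext p
  change _ = substLabel _ _ p
  rcases p with _ | ⟨i, p⟩
  · rw [substLabel_of_inner _ _ (.inr (.inl rfl)) (app_label_nil _ _)]
    rfl
  · fin_cases i
    · rw [substLabel_outside]
      · simp [omega, app_label_cons_zero]
      · rintro (_ | ⟨j, q⟩) hp
        · simp [app_label_nil]
        · obtain ⟨rfl, -⟩ := List.cons_prefix_cons.1 hp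
          simp [app_label_cons_zero]
    -- The two occurrences of `x` in `x x` are at `[1]` and `[2]`; each is replaced by a copy of
    -- `λx. x x`.
    · exact (app_label_cons_one _ _ p).trans (substLabel_inside _ (selfApp V) (p₁ := [1]) p rfl).symm
    · exact (app_label_cons_two _ _ p).trans (substLabel_inside _ (selfApp V) (p₁ := [2]) p rfl).symm

end LTree

/-- The renaming of `x` to `some x`. -/
def Label.weaken {V : Type u} : Label V → Label (Option V)
  | .lam => .lam
  | .app => .app
  | .bvar q => .bvar q
  | .fvar x => .fvar (some x)

theorem Label.strip_weaken {V : Type u} (l : Label V) : l.weaken.strip = some l := by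
  cases l <;> rfl

namespace LTree

variable {V : Type u}

open Classical in
/-- The tree `t` with the variable `none` at its `⊥`-positions. -/
noncomputable def hole (t : LTree V) : LTree (Option V) where
  label p := if t.BotPos p then some (.fvar none) else (t.label p).map Label.weaken
  lam_of_child := by
    intro p h
    have hp : t.label p = some .lam := by
      split_ifs at h with hb
      · generalize hq : p ++ [0] = q at hb
        cases hb with
        | root => simp at hq
        | lam r h1 h2 => rwa [(List.append_inj' hq rfl).1]
        | app r i hi h1 h2 =>
          have := (List.append_inj' hq rfl).2
          rcases hi with rfl | rfl <;> simp at this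
      · exact t.lam_of_child p (by simpa using h)
    have : ¬ t.BotPos p := fun hb => by simp [hb.label] at hp
    simp [this, hp, Label.weaken]
  app_of_child := by
    intro p i hi h
    have hp : t.label p = some .app := by
      split_ifs at h with hb
      · generalize hq : p ++ [i] = q at hb
        cases hb with
        | root => simp at hq
        | lam r h1 h2 => exact absurd (by simpa using (List.append_inj' hq rfl).2) hi
        | app r j hj h1 h2 => rwa [(List.append_inj' hq rfl).1]
      · exact t.app_of_child p i hi (by simpa using h)
    have : ¬ t.BotPos p := fun hb => by simp [hb.label] at hp
    simp [this, hp, Label.weaken]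
  binder := by
    intro p q h
    split_ifs at h with hb
    · simp at h
    · rw [Option.map_eq_some_iff] at h
      obtain ⟨l, hl, h⟩ := h
      obtain rfl : l = .bvar q := by cases l <;> simp_all [Label.weaken]
      obtain ⟨h1, h2⟩ := t.binder _ _ hl
      have : ¬ t.BotPos q := fun hb => by simp [hb.label] at h2
      exact ⟨h1, by simp [this, h2, Label.weaken]⟩

theorem hole_label_of_botPos {t : LTree V} {p : Pos} (h : t.BotPos p) :
    t.hole.label p = some (.fvar none) := if_pos h

theorem hole_label {t : LTree V} {p : Pos} (h : ¬ t.BotPos p) :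
    t.hole.label p = (t.label p).map Label.weaken := if_neg h

theorem hole_label_of_some {t : LTree V} {p : Pos} {l : Label V} (h : t.label p = some l) :
    t.hole.label p = some l.weaken := by
  rw [hole_label (fun hb => by simp [hb.label] at h), h]
  rfl

theorem total_hole (t : LTree V) : t.hole.Total := by
  have key : ∀ p l, t.hole.label p = some l → l = .lam ∨ l = .app →
      (l = .lam ∧ t.label p = some .lam) ∨ (l = .app ∧ t.label p = some .app) := by
    intro p l hl hl'
    by_cases h : t.BotPos p
    · rw [hole_label_of_botPos h] at hl
      rcases hl' with rfl | rfl <;> simp at hl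
    · rw [hole_label h, Option.map_eq_some_iff] at hl
      obtain ⟨m, hm, rfl⟩ := hl
      cases m <;> simp_all [Label.weaken]
  have key2 : ∀ p, (t.label p = none → t.BotPos p) → t.hole.label p ≠ none := by
    intro p hp
    by_cases h : t.BotPos p
    · simp [hole_label_of_botPos h]
    · rw [hole_label h]
      simpa using mt hp h
  rw [total_iff]
  refine ⟨key2 _ .root, fun p hp => key2 _ (.lam p ?_), fun p i hi hp => key2 _ (.app p i hi ?_)⟩
  · simpa using key p _ hp (.inl rfl)
  · simpa using key p _ hp (.inr rfl)

theorem guarded_hole {a : Sig} {t : LTree V} (ht : t.Guarded a) : t.hole.Guarded a := by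
  intro b hb
  refine ht b fun n hn => ?_
  have h := hb (n + 1)
  rw [pref_succ] at h
  have := t.hole.inner (p := pref b n) (by simp) h
  by_cases hp : t.BotPos (pref b n)
  · simp [hole_label_of_botPos hp] at this
  · simp [hole_label hp, hn] at this

/-- The tree `t` with `omega` at its `⊥`-positions. -/
noncomputable def fill (t : LTree V) : LTree V := subst t.hole (omega V)

theorem total_fill (t : LTree V) : t.fill.Total := total_subst t.total_hole total_omega

theorem guarded_fill {a : Sig} {t : LTree V} (ht : t.Guarded a) : t.fill.Guarded a :=
  guarded_subst (guarded_hole ht) (guarded_omega a)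

theorem sub_fill (t : LTree V) : t.Sub t.fill := by
  intro p l hl
  have h := hole_label_of_some hl
  change substLabel _ _ p = _
  rw [substLabel_of_ne h (by cases l <;> simp [Label.weaken]), Label.strip_weaken]

theorem fill_label_of_botPos {t : LTree V} {p : Pos} (h : t.BotPos p) (q : Pos) :
    t.fill.label (p ++ q) = ((omega V).label q).map (Label.shift p) :=
  substLabel_inside _ _ _ (hole_label_of_botPos h)

theorem subtree_fill {t : LTree V} {p : Pos} (h : t.BotPos p) :
    t.fill.subtree p = omega (V ⊕ Pos) := by
  -- As `omega` is closed, `Label.cutAt p` merely undoes `Label.shift p`. What remains is to compare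
  -- `omega` over two sets of variables, and this is a finite check since its positions have length
  -- at most 3.
  have key : ∀ (x y : Option (Label V)), (∀ l, y = some l → l = .lam ∨ l = .app ∨ ∃ q, l = .bvar q) →
      x = y.map (Label.shift p) → x.map (Label.cutAt p) = y.map (fun l => match l with
        | .lam => .lam
        | .app => .app
        | .bvar q => .bvar q
        | .fvar x => .fvar (Sum.inl x)) := by
    rintro _ (_ | l) hl rfl
    · rfl
    · rcases hl l rfl with rfl | rfl | ⟨q, rfl⟩ <;> simp [Label.shift, Label.cutAt]
  ext1
  funext q
  refine (key _ _ (fun l => omega_label) (fill_label_of_botPos h q)).trans ?_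
  rcases q with _ | ⟨i, _ | ⟨j, _ | ⟨k, _ | ⟨m, q⟩⟩⟩⟩
  · rfl
  · fin_cases i <;> rfl
  · fin_cases i <;> fin_cases j <;> rfl
  · fin_cases i <;> fin_cases j <;> fin_cases k <;> rfl
  · fin_cases i <;> fin_cases j <;> fin_cases k <;> rfl

end LTree

open LTree

variable {a : Sig} {V : Type u} {R : RewriteSystem.{u}}

/-! ### Single steps -/

theorem step_cons_zero {p : Pos} {s t : LTree V} :
    Step R (0 :: p) s t ↔
      ∃ r r' : LTree (Option V), s = r.abs ∧ t = r'.abs ∧ Step R p r r' := by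
  simp [Step]

theorem step_cons_one {p : Pos} {s t : LTree V} :
    Step R (1 :: p) s t ↔ ∃ r r' w : LTree V, s = r.app w ∧ t = r'.app w ∧ Step R p r r' := by
  simp [Step]

theorem step_cons_two {p : Pos} {s t : LTree V} :
    Step R (2 :: p) s t ↔ ∃ r r' w : LTree V, s = w.app r ∧ t = w.app r' ∧ Step R p r r' := by
  simp [Step]

/-- `Step` recurses on the position while the set of variables grows under abstractions; this
packages the recursion as induction on the context of the contracted subtree. -/
theorem Step.induction
    {motive : ∀ {p : Pos} {V : Type u} {s t : LTree V}, Step R p s t → Prop}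
    (root : ∀ {V : Type u} (s t : LTree V) (h : R V s t), motive (p := []) h)
    (abs : ∀ {V : Type u} (p : Pos) (r r' : LTree (Option V)) (h : Step R p r r'), motive h →
      motive (step_cons_zero.2 ⟨r, r', rfl, rfl, h⟩))
    (appl : ∀ {V : Type u} (p : Pos) (r r' w : LTree V) (h : Step R p r r'), motive h →
      motive (step_cons_one.2 ⟨r, r', w, rfl, rfl, h⟩))
    (appr : ∀ {V : Type u} (p : Pos) (r r' w : LTree V) (h : Step R p r r'), motive h →
      motive (step_cons_two.2 ⟨r, r', w, rfl, rfl, h⟩))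
    {p : Pos} {V : Type u} {s t : LTree V} (h : Step R p s t) : motive h := by
  induction p generalizing V s t with
  | nil => exact root _ _ h
  | cons i p ih =>
    have h' := h
    rcases h' with ⟨rfl, r, r', rfl, rfl, h'⟩ | ⟨rfl, r, r', w, rfl, rfl, h'⟩ |
      ⟨rfl, r, r', w, rfl, rfl, h'⟩
    · exact abs _ _ _ h' (ih h')
    · exact appl _ _ _ _ h' (ih h')
    · exact appr _ _ _ _ h' (ih h')

theorem Step.label_eq {p : Pos} {s t : LTree V} (h : Step R p s t) :
    ∀ q, ¬ p <+: q → s.label q = t.label q := by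
  induction h using Step.induction with
  | root s t h => exact fun q hq => absurd (List.nil_prefix) hq
  | abs p r r' _ ih =>
    rintro (_ | ⟨i, q⟩) hq
    · rfl
    · by_cases hi : i = 0
      · subst hi
        rw [abs_label_cons, abs_label_cons, ih q fun h => hq (List.cons_prefix_cons.2 ⟨rfl, h⟩)]
      · rw [abs_label_cons_ne _ hi, abs_label_cons_ne _ hi]
  | appl p r r' w _ ih =>
    rintro (_ | ⟨i, q⟩) hq
    · rfl
    · fin_cases i
      · rfl
      · simp only [Fin.mk_one, app_label_cons_one]
        rw [ih q fun h => hq (List.cons_prefix_cons.2 ⟨rfl, h⟩)]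
      · simp only [Fin.reduceFinMk, app_label_cons_two]
  | appr p r r' w _ ih =>
    rintro (_ | ⟨i, q⟩) hq
    · rfl
    · fin_cases i
      · rfl
      · simp only [Fin.mk_one, app_label_cons_one]
      · simp only [Fin.reduceFinMk, app_label_cons_two]
        rw [ih q fun h => hq (List.cons_prefix_cons.2 ⟨rfl, h⟩)]

theorem Step.label_eq_of_depth_lt {p q : Pos} {s t : LTree V} (h : Step R p s t)
    (hq : depth a q < depth a p) : s.label q = t.label q :=
  h.label_eq q fun hp => absurd (depth_mono a hp) (by omega)

theorem Step.beta_or_bot {U : TreeSet.{u}} {p : Pos} {s t : LTree V}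
    (h : Step (bohmSystem U) p s t) : Step betaRule p s t ∨ Step (botRule U) p s t := by
  induction h using Step.induction with
  | root s t h => exact h
  | abs p r r' _ ih =>
    exact ih.imp (fun h => step_cons_zero.2 ⟨_, _, rfl, rfl, h⟩)
      (fun h => step_cons_zero.2 ⟨_, _, rfl, rfl, h⟩)
  | appl p r r' w _ ih =>
    exact ih.imp (fun h => step_cons_one.2 ⟨_, _, _, rfl, rfl, h⟩)
      (fun h => step_cons_one.2 ⟨_, _, _, rfl, rfl, h⟩)
  | appr p r r' w _ ih =>
    exact ih.imp (fun h => step_cons_two.2 ⟨_, _, _, rfl, rfl, h⟩)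
      (fun h => step_cons_two.2 ⟨_, _, _, rfl, rfl, h⟩)

theorem Step.guarded_of_beta {p : Pos} {s t : LTree V} (h : Step betaRule p s t) :
    s.Guarded a → t.Guarded a := by
  induction h using Step.induction with
  | root s t h =>
    obtain ⟨r, w, rfl, rfl⟩ := h
    rw [guarded_app, guarded_abs]
    exact fun h => guarded_subst h.1 h.2
  | abs p r r' _ ih => simpa only [guarded_abs] using ih
  | appl p r r' w _ ih => simpa only [guarded_app] using And.imp_left ih
  | appr p r r' w _ ih => simpa only [guarded_app] using And.imp_right ih

theorem Step.label_ne_none_of_beta {p : Pos} {s t : LTree V} (h : Step betaRule p s t) :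
    s.label p ≠ none := by
  induction h using Step.induction with
  | root s t h =>
    obtain ⟨r, w, rfl, rfl⟩ := h
    simp [app_label_nil]
  | abs p r r' _ ih => simpa [abs_label_cons] using ih
  | appl p r r' w _ ih => simpa [app_label_cons_one] using ih
  | appr p r r' w _ ih => simpa [app_label_cons_two] using ih

/-- A `β`-redex is recognised from two inner labels, which persist when subtrees are added, and
substitution is monotone; so the step can be repeated at the same position. -/
theorem Step.exists_of_sub {p : Pos} {s t : LTree V} (h : Step betaRule p s t) :
    ∀ u, s.Sub u → ∃ u', Step betaRule p u u' ∧ t.Sub u' := by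
  induction h using Step.induction with
  | root s t h =>
    obtain ⟨r, w, rfl, rfl⟩ := h
    intro u hu
    obtain ⟨u, w', rfl, hr, hw⟩ := exists_of_app_sub hu
    obtain ⟨r', rfl, hr'⟩ := exists_of_abs_sub hr
    exact ⟨_, ⟨r', w', rfl, rfl⟩, hr'.subst hw⟩
  | abs p r r' _ ih =>
    intro u hu
    obtain ⟨u, rfl, hr⟩ := exists_of_abs_sub hu
    obtain ⟨u', h1, h2⟩ := ih u hr
    exact ⟨_, step_cons_zero.2 ⟨_, _, rfl, rfl, h1⟩, sub_abs_iff.2 h2⟩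
  | appl p r r' w _ ih =>
    intro u hu
    obtain ⟨u, w', rfl, hr, hw⟩ := exists_of_app_sub hu
    obtain ⟨u', h1, h2⟩ := ih u hr
    exact ⟨_, step_cons_one.2 ⟨_, _, _, rfl, rfl, h1⟩, sub_app_iff.2 ⟨h2, hw⟩⟩
  | appr p r r' w _ ih =>
    intro u hu
    obtain ⟨w', u, rfl, hw, hr⟩ := exists_of_app_sub hu
    obtain ⟨u', h1, h2⟩ := ih u hr
    exact ⟨_, step_cons_two.2 ⟨_, _, _, rfl, rfl, h1⟩, sub_app_iff.2 ⟨hw, h2⟩⟩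

theorem Step.sub_of_bot {U : TreeSet.{u}} {p : Pos} {s t : LTree V}
    (h : Step (botRule U) p s t) : t.Sub s := by
  induction h using Step.induction with
  | root s t h =>
    obtain ⟨-, -, rfl⟩ := h
    exact fun p l hl => by simp [bot] at hl
  | abs p r r' _ ih => exact sub_abs_iff.2 ih
  | appl p r r' w _ ih => exact sub_app_iff.2 ⟨ih, .refl w⟩
  | appr p r r' w _ ih => exact sub_app_iff.2 ⟨.refl w, ih⟩

/-- Used to exclude `⊥`-steps at depth zero: the hole left at `p` is where `fill` puts a copy of
`omega`. -/
theorem Step.botPos_of_bot {U : TreeSet.{u}} {p : Pos} {s t : LTree V}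
    (h : Step (botRule U) p s t) : t.BotPos p := by
  induction h using Step.induction with
  | root s t h =>
    obtain ⟨-, -, rfl⟩ := h
    exact .root rfl
  | abs p r r' _ ih => exact botPos_abs ih
  | appl p r r' w _ ih => exact botPos_child (.inl rfl) (app_label_cons_one _ _) rfl ih
  | appr p r r' w _ ih => exact botPos_child (.inr rfl) (app_label_cons_two _ _) rfl ih

/-- A tree with `omega` at `p` reduces to itself. -/
theorem step_beta_self {p : Pos} {u : LTree V}
    (h : ∀ q, u.label (p ++ q) = ((omega V).label q).map (Label.shift p)) :
    Step betaRule p u u := by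
  induction p generalizing V with
  | nil =>
    have : u = omega V := by
      ext1
      funext q
      have hs : (Label.shift [] : Label V → Label V) = id := by
        funext l
        cases l <;> rfl
      simpa [hs] using h q
    subst this
    exact betaRule_omega
  | cons i p ih =>
    have hne : u.label ([i] ++ p) ≠ none := by
      have := h []
      simp only [List.append_nil, omega, app_label_nil] at this
      simp [this]
    have hroot := u.label_ne_none_of_prefix (List.prefix_append _ _) hne
    have hshift : Label.shift (i :: p) = Label.shift [i] ∘ (Label.shift p : Label V → Label V) :=
      funext fun l => (Label.shift_shift [i] p l).symm
    fin_cases i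
    · obtain ⟨r, rfl⟩ := u.exists_abs (u.lam_of_child [] hroot)
      refine step_cons_zero.2 ⟨r, r, rfl, rfl, ih fun q => ?_⟩
      have hq := h q
      simp only [Fin.zero_eta, List.cons_append, abs_label_cons] at hq
      -- Going under the abstraction adds a variable, which does not matter as `omega` is closed;
      -- again a finite check.
      have hlab : (omega (Option V)).label q = ((omega V).label q).map Label.weaken := by
        rcases q with _ | ⟨i, _ | ⟨j, _ | ⟨k, _ | ⟨m, q⟩⟩⟩⟩
        · rfl
        · fin_cases i <;> rfl
        · fin_cases i <;> fin_cases j <;> rfl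
        · fin_cases i <;> fin_cases j <;> fin_cases k <;> rfl
        · fin_cases i <;> fin_cases j <;> fin_cases k <;> rfl
      rw [hlab]
      apply (map_inj_iff Label.close_injective).1
      rw [hq]
      rcases hl : (omega V).label q with _ | l
      · rfl
      · rcases omega_label hl with rfl | rfl | ⟨q, rfl⟩ <;> rfl
    · obtain ⟨r, w, rfl⟩ := u.exists_app (u.app_of_child [] 1 (by simp) hroot)
      refine step_cons_one.2 ⟨r, r, w, rfl, rfl, ih fun q => ?_⟩
      have hq := h q
      simp only [Fin.mk_one, List.cons_append, app_label_cons_one] at hq hshift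
      rw [hshift, ← Option.map_map, map_inj_iff (Label.shift_injective _)] at hq
      exact hq
    · obtain ⟨w, r, rfl⟩ := u.exists_app (u.app_of_child [] 2 (by simp) hroot)
      refine step_cons_two.2 ⟨r, r, w, rfl, rfl, ih fun q => ?_⟩
      have hq := h q
      simp only [Fin.reduceFinMk, List.cons_append, app_label_cons_two] at hq hshift
      rw [hshift, ← Option.map_map, map_inj_iff (Label.shift_injective _)] at hq
      exact hq

/-! ### Restrictions, greatest lower bounds and reduction contexts -/

open Classical in
/-- The restriction of `t` to a set of positions that is closed under prefixes. -/
noncomputable def LTree.restrict (t : LTree V) (S : Set Pos) (hS : ∀ p q, p <+: q → q ∈ S → p ∈ S) :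
    LTree V where
  label p := if p ∈ S then t.label p else none
  lam_of_child := by
    intro p h
    split_ifs at h with hp
    · rw [if_pos (hS _ _ (List.prefix_append _ _) hp), t.lam_of_child p h]
    · simp at h
  app_of_child := by
    intro p i hi h
    split_ifs at h with hp
    · rw [if_pos (hS _ _ (List.prefix_append _ _) hp), t.app_of_child p i hi h]
    · simp at h
  binder := by
    intro p q h
    split_ifs at h with hp
    obtain ⟨h1, h2⟩ := t.binder _ _ h
    exact ⟨h1, by rw [if_pos (hS _ _ h1 hp), h2]⟩

theorem LTree.mem_dom_restrict {t : LTree V} {S : Set Pos}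
    {hS : ∀ p q, p <+: q → q ∈ S → p ∈ S} {p : Pos} :
    p ∈ (t.restrict S hS).dom ↔ p ∈ S ∧ p ∈ t.dom := by
  by_cases h : p ∈ S <;> simp [restrict, dom, h]

theorem LTree.restrict_label {t : LTree V} {S : Set Pos}
    {hS : ∀ p q, p <+: q → q ∈ S → p ∈ S} {p : Pos} (hp : p ∈ S) :
    (t.restrict S hS).label p = t.label p := if_pos hp

theorem LTree.dom_of_prefix {t : LTree V} {p q : Pos} (h : p <+: q) (hq : q ∈ t.dom) :
    p ∈ t.dom := t.label_ne_none_of_prefix h hq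

/-- The restriction of a guarded tree to a set of positions that is closed under prefixes. -/
noncomputable def GTree.restrict (t : GTree a V) (S : Set Pos)
    (hS : ∀ p q, p <+: q → q ∈ S → p ∈ S) : GTree a V :=
  ⟨t.1.restrict S hS, fun b hb => t.2 b fun n => (mem_dom_restrict.1 (hb n)).2⟩

theorem GTree.mem_dom_restrict {t : GTree a V} {S : Set Pos}
    {hS : ∀ p q, p <+: q → q ∈ S → p ∈ S} {p : Pos} :
    p ∈ (t.restrict S hS).1.dom ↔ p ∈ S ∧ p ∈ t.1.dom :=
  LTree.mem_dom_restrict (hS := hS)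

theorem GTree.restrict_label {t : GTree a V} {S : Set Pos}
    {hS : ∀ p q, p <+: q → q ∈ S → p ∈ S} {p : Pos} (hp : p ∈ (t.restrict S hS).1.dom) :
    (t.restrict S hS).1.label p = t.1.label p :=
  LTree.restrict_label (hS := hS) (GTree.mem_dom_restrict.1 hp).1

theorem GTree.restrict_le {t : GTree a V} {S : Set Pos}
    {hS : ∀ p q, p <+: q → q ∈ S → p ∈ S}
    (h : ∀ (p : Pos) (i : Fin 3), a i = 0 → p ∈ S → p ++ [i] ∈ t.1.dom → p ++ [i] ∈ S) :
    t.restrict S hS ≤ t :=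
  ⟨fun _ hp => (mem_dom_restrict.1 hp).2, fun _ hp => restrict_label hp,
    fun p i hi hpt hp => mem_dom_restrict.2 ⟨h p i hi (mem_dom_restrict.1 hp).1 hpt, hpt⟩⟩

theorem GTree.le_restrict {l t : GTree a V} {S : Set Pos}
    {hS : ∀ p q, p <+: q → q ∈ S → p ∈ S} (h : l ≤ t) (hl : l.1.dom ⊆ S) :
    l ≤ t.restrict S hS := by
  have hd : ∀ p ∈ l.1.dom, p ∈ (t.restrict S hS).1.dom := fun p hp =>
    mem_dom_restrict.2 ⟨hl hp, h.1 hp⟩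
  exact ⟨hd, fun p hp => (h.2.1 p hp).trans (restrict_label (hd p hp)).symm,
    fun p i hi hpt hp => h.2.2 p i hi (mem_dom_restrict.1 hpt).2 hp⟩

/-- All lower bounds agree with a fixed member `c₀` of `S` on their domains, so the restriction of
`c₀` to the union of these domains is the greatest one. -/
theorem GTree.exists_isGLB {S : Set (GTree a V)} (hS : S.Nonempty) : ∃ g, IsGLB S g := by
  obtain ⟨c₀, hc₀⟩ := hS
  have hpre : ∀ p q, p <+: q → q ∈ {p | ∃ l ∈ lowerBounds S, p ∈ l.1.dom} →
      p ∈ {p | ∃ l ∈ lowerBounds S, p ∈ l.1.dom} := by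
    rintro p q hpq ⟨l, hl, hq⟩
    exact ⟨l, hl, dom_of_prefix hpq hq⟩
  refine ⟨c₀.restrict _ hpre, ?_, fun l hl => le_restrict (hl hc₀) fun p hp => ⟨l, hl, hp⟩⟩
  intro c hc
  refine ⟨fun p hp => ?_, fun p hp => ?_, fun p i hi hpc hp => ?_⟩
  · obtain ⟨⟨l, hl, hp⟩, -⟩ := mem_dom_restrict.1 hp
    exact (hl hc).1 hp
  · rw [restrict_label hp]
    obtain ⟨⟨l, hl, hp⟩, -⟩ := mem_dom_restrict.1 hp
    rw [← (hl hc₀).2.1 p hp, (hl hc).2.1 p hp]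
  · obtain ⟨⟨l, hl, hp⟩, -⟩ := mem_dom_restrict.1 hp
    have := (hl hc).2.2 p i hi hpc hp
    exact mem_dom_restrict.2 ⟨⟨l, hl, this⟩, (hl hc₀).1 this⟩

theorem cut_prefix (a : Sig) (p : Pos) : cut a p <+: p := List.rdropWhile_prefix _ _

theorem exists_eq_cut_append (a : Sig) (p : Pos) : ∃ w, p = cut a p ++ w ∧ ∀ i ∈ w, a i = 0 := by
  induction p using List.reverseRecOn with
  | nil => exact ⟨[], rfl, by simp⟩
  | append_singleton p i ih =>
    by_cases hi : a i = 0
    · obtain ⟨w, h1, h2⟩ := ih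
      refine ⟨w ++ [i], ?_, ?_⟩
      · rw [cut, List.rdropWhile_concat_pos _ _ _ (by simpa using hi), ← List.append_assoc]
        exact congrArg (· ++ [i]) h1
      · intro j hj
        rcases List.mem_append.1 hj with hj | hj
        · exact h2 j hj
        · simpa [List.mem_singleton.1 hj] using hi
    · exact ⟨[], by rw [cut, List.rdropWhile_concat_neg _ _ _ (by simpa using hi)]; simp, by simp⟩

theorem cut_ne_append_strict (a : Sig) (p q : Pos) {i : Fin 3} (hi : a i = 0) :
    cut a p ≠ q ++ [i] := by
  intro h
  have hne : cut a p ≠ [] := by simp [h]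
  have := List.rdropWhile_last_not (fun i => decide (a i = 0)) p hne
  unfold cut at h
  simp only [h, List.getLast_append_singleton] at this
  simp [hi] at this

theorem depth_cut (a : Sig) (p : Pos) : depth a (cut a p) = depth a p := by
  obtain ⟨w, h1, h2⟩ := exists_eq_cut_append a p
  conv_rhs => rw [h1, depth_append]
  have : depth a w = 0 := by
    clear h1
    induction w with
    | nil => rfl
    | cons i w ih =>
      rw [depth_cons, ih fun j hj => h2 j (List.mem_cons_of_mem _ hj), h2 i (by simp)]
      rfl
  omega

/-- This identifies contractions at depth zero with those that count towards destructiveness. -/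
theorem cut_eq_nil {p : Pos} (hp : depth a p = 0) : cut a p = [] := by
  rcases List.eq_nil_or_concat (cut a p) with h | ⟨q, i, h⟩
  · exact h
  · rw [List.concat_eq_append] at h
    have h1 := depth_cut a p
    rw [h, depth_append, hp] at h1
    have h2 : (a i : ℕ) = 0 := by
      simp only [depth_cons, depth_nil] at h1
      omega
    exact absurd h (cut_ne_append_strict a p q (Fin.ext h2))

/-- The reduction context of a step from `t` at `p`. -/
noncomputable def GTree.context (t : GTree a V) (p : Pos) : GTree a V :=
  t.restrict {q | ¬ cut a p <+: q} fun _ _ h hq h' => hq (h'.trans h)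

theorem GTree.mem_dom_context {t : GTree a V} {p q : Pos} :
    q ∈ (t.context p).1.dom ↔ ¬ cut a p <+: q ∧ q ∈ t.1.dom := mem_dom_restrict

theorem not_cut_prefix_append {p q : Pos} {i : Fin 3} (hi : a i = 0) (hq : ¬ cut a p <+: q) :
    ¬ cut a p <+: q ++ [i] := by
  intro h
  rcases List.prefix_concat_iff.1 h with h | h
  · exact cut_ne_append_strict a p q hi h
  · exact hq h

theorem GTree.context_le (t : GTree a V) (p : Pos) : t.context p ≤ t :=
  restrict_le fun _ _ hi hq _ => not_cut_prefix_append hi hq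

/-- The order does not allow the removal of a strict position alone. If `c ≤ s` contained `cut a p`,
it would contain all strict descendants down to `p`; so excluding `p` forces the removal of
everything below `cut a p`, and nothing else has to be removed. -/
theorem isRedContext_context {p : Pos} {s t : GTree a V} (h : Step betaRule p s.1 t.1) :
    IsRedContext p s t (s.context p) := by
  have hlab : ∀ q, ¬ cut a p <+: q → s.1.label q = t.1.label q := fun q hq =>
    h.label_eq q fun h' => hq ((cut_prefix a p).trans h')
  refine ⟨⟨s.context_le p, ⟨fun q hq => ?_, fun q hq => ?_, fun q i hi hqt hq => ?_⟩,
    fun hp => (GTree.mem_dom_context.1 hp).1 (cut_prefix a p)⟩, ?_⟩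
  · obtain ⟨h1, h2⟩ := GTree.mem_dom_context.1 hq
    rw [dom, Set.mem_ofPred_eq, hlab q h1] at h2
    exact h2
  · exact (GTree.restrict_label hq).trans (hlab q (GTree.mem_dom_context.1 hq).1)
  · have h1 := not_cut_prefix_append hi (GTree.mem_dom_context.1 hq).1
    rw [dom, Set.mem_ofPred_eq, ← hlab _ h1] at hqt
    exact GTree.mem_dom_context.2 ⟨h1, hqt⟩
  · rintro c ⟨hcs, -, hp⟩
    refine GTree.le_restrict hcs fun q hq h' => ?_
    have hc := dom_of_prefix h' hq
    obtain ⟨w, h1, h2⟩ := exists_eq_cut_append a p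
    have hs := h.label_ne_none_of_beta
    rw [h1] at hs hp
    clear h1
    refine hp ?_
    clear hp
    induction w using List.reverseRecOn with
    | nil => simpa using hc
    | append_singleton w i ih =>
      rw [← List.append_assoc] at hs ⊢
      exact hcs.2.2 _ i (h2 i (by simp)) hs (ih (fun j hj => h2 j (by simp [hj]))
        (s.1.label_ne_none_of_prefix (List.prefix_append _ _) hs))

/-! ### Strong convergence at a limit ordinal -/

/-- The trees `tr ι`, `ι < γ`, and the depths of the positions `pos ι` converge to `T` and to
infinity. -/
def ConvergesAt (γ : Ordinal.{0}) (tr : Ordinal.{0} → GTree a V) (pos : Ordinal.{0} → Pos)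
    (T : GTree a V) : Prop :=
  ∀ d, ∃ β < γ, ∀ ι, β ≤ ι → ι < γ →
    d ≤ depth a (pos ι) ∧ ∀ p, depth a p < d → (tr ι).1.label p = T.1.label p

theorem treeDist_le {s t : LTree V} {d : ℕ} (h : ∀ p, depth a p < d → s.label p = t.label p) :
    treeDist a s t ≤ (1 / 2 : ℝ) ^ d := by
  unfold treeDist
  split_ifs with hst
  · positivity
  · refine pow_le_pow_of_le_one (by norm_num) (by norm_num) (le_csInf ?_ ?_)
    -- The infimum of an empty set of naturals is 0, so distinct trees must be shown to differ
    -- somewhere.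
    · by_contra hc
      rw [Set.not_nonempty_iff_eq_empty, Set.eq_empty_iff_forall_notMem] at hc
      refine hst (LTree.ext (funext fun p => ?_))
      by_contra hp
      exact hc _ ⟨p, rfl, hp⟩
    · rintro _ ⟨p, rfl, hp⟩
      by_contra hlt
      exact hp (h p (by omega))

theorem ConvergesAt.hasLimit {γ : Ordinal.{0}} {tr : Ordinal.{0} → GTree a V}
    {pos : Ordinal.{0} → Pos} {T : GTree a V} (h : ConvergesAt γ tr pos T) : HasLimit γ tr T := by
  intro ε hε
  obtain ⟨d, hd⟩ := exists_pow_lt_of_lt_one hε (by norm_num : (1 / 2 : ℝ) < 1)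
  obtain ⟨β, hβ, hβ'⟩ := h d
  exact ⟨β, hβ, fun ι h1 h2 => (treeDist_le (hβ' ι h1 h2).2).trans_lt hd⟩

/-- Once all contractions are at depth at least `d` and the trees agree with `T` below depth `d`,
every context lies above the truncation of `T` at depth `d`. These truncations exhaust `T`.
Conversely, a lower bound of the late contexts lies below late trees, which agree with `T` at any
given position. -/
theorem ConvergesAt.isLiminf {γ : Ordinal.{0}} {tr : Ordinal.{0} → GTree a V}
    {pos : Ordinal.{0} → Pos} {T : GTree a V} (h : ConvergesAt γ tr pos T) :
    IsLiminf γ (fun ι => (tr ι).context (pos ι)) T := by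
  constructor
  · rintro g ⟨β, hβ, hg⟩
    have hgt : ∀ ι, β ≤ ι → ι < γ → g ≤ tr ι := fun ι h1 h2 =>
      (hg.1 ⟨ι, ⟨h1, h2⟩, rfl⟩).trans ((tr ι).context_le (pos ι))
    have hlate : ∀ p, ∃ ι, g ≤ tr ι ∧ (tr ι).1.label p = T.1.label p := by
      intro p
      obtain ⟨β', h1, h2⟩ := h (depth a p + 1)
      exact ⟨max β β', hgt _ (le_max_left _ _) (max_lt hβ h1),
        (h2 _ (le_max_right _ _) (max_lt hβ h1)).2 p (Nat.lt_succ_self _)⟩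
    refine ⟨fun p hp => ?_, fun p hp => ?_, fun p i hi hpT hp => ?_⟩
    · obtain ⟨ι, h1, h2⟩ := hlate p
      have := h1.1 hp
      rwa [dom, Set.mem_ofPred_eq, h2] at this
    · obtain ⟨ι, h1, h2⟩ := hlate p
      rw [h1.2.1 p hp, h2]
    · obtain ⟨ι, h1, h2⟩ := hlate (p ++ [i])
      rw [dom, Set.mem_ofPred_eq, ← h2] at hpT
      exact h1.2.2 p i hi hpT hp
  · intro b hb
    have hpre : ∀ d p q, p <+: q → q ∈ {p | depth a p < d} → p ∈ {p | depth a p < d} :=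
      fun d p q h hq => (depth_mono a h).trans_lt hq
    have key : ∀ d, T.restrict {p | depth a p < d} (hpre d) ≤ b := by
      intro d
      obtain ⟨β, hβ, hβ'⟩ := h d
      obtain ⟨g, hg⟩ := GTree.exists_isGLB (S := (fun ι => (tr ι).context (pos ι)) '' Set.Ico β γ)
        ⟨_, β, ⟨le_rfl, hβ⟩, rfl⟩
      refine le_trans (hg.2 ?_) (hb ⟨β, hβ, hg⟩)
      rintro _ ⟨ι, ⟨h1, h2⟩, rfl⟩
      obtain ⟨h3, h4⟩ := hβ' ι h1 h2
      refine GTree.le_restrict ⟨fun p hp => ?_, fun p hp => ?_, fun p i hi hpt hp => ?_⟩ ?_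
      · obtain ⟨h5, h6⟩ := GTree.mem_dom_restrict.1 hp
        rw [dom, Set.mem_ofPred_eq, h4 p h5]
        exact h6
      · exact (GTree.restrict_label hp).trans (h4 p (GTree.mem_dom_restrict.1 hp).1).symm
      · have h7 : depth a (p ++ [i]) < d := by
          rw [depth_append, depth_cons, hi]
          simpa [depth_nil] using (GTree.mem_dom_restrict.1 hp).1
        refine GTree.mem_dom_restrict.2 ⟨h7, ?_⟩
        rw [dom, Set.mem_ofPred_eq, ← h4 _ h7]
        exact hpt
      -- Since `cut a (pos ι)` has the same depth as `pos ι`, which is at least `d`, no position of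
      -- depth less than `d` extends it.
      · intro p hp h'
        have h8 := depth_mono a h'
        have h9 : depth a p < d := (GTree.mem_dom_restrict.1 hp).1
        rw [depth_cut] at h8
        omega
    have hmem : ∀ p ∈ T.1.dom, p ∈ (T.restrict _ (hpre (depth a p + 1))).1.dom := fun p hp =>
      GTree.mem_dom_restrict.2 ⟨Nat.lt_succ_self (depth a p), hp⟩
    refine ⟨fun p hp => (key _).1 (hmem p hp), fun p hp => ?_, fun p i hi hpb hp => ?_⟩
    · rw [← (key _).2.1 p (hmem p hp), GTree.restrict_label (hmem p hp)]
    · exact (GTree.mem_dom_restrict.1 ((key _).2.2 p i hi hpb (hmem p hp))).2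

/-! ### Infinitary reduction without ordinals -/

/-- The guarded lambda trees `f n` converge to `T`. -/
def LimTo (f : ℕ → GTree a V) (T : GTree a V) : Prop :=
  ∀ d, ∃ N, ∀ n ≥ N, ∀ p, depth a p < d → (f n).1.label p = T.1.label p

theorem LimTo.unique {f : ℕ → GTree a V} {T T' : GTree a V} (h : LimTo f T) (h' : LimTo f T') :
    T = T' := by
  refine Subtype.ext (LTree.ext (funext fun p => ?_))
  obtain ⟨N, hN⟩ := h (depth a p + 1)
  obtain ⟨N', hN'⟩ := h' (depth a p + 1)
  rw [← hN (max N N') (le_max_left _ _) p (Nat.lt_succ_self _),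
    hN' (max N N') (le_max_right _ _) p (Nat.lt_succ_self _)]

/-- The sequence `e` of natural numbers is unbounded in the limit. -/
def Diverges (e : ℕ → ℕ) : Prop := ∀ m, ∃ N, ∀ n ≥ N, m ≤ e n

/-- `Red R d s t`: there is a strongly `m`-convergent reduction from `s` to `t` at positions of
depth at least `d`. -/
inductive Red (R : RewriteSystem.{u}) : ℕ → GTree a V → GTree a V → Prop
  | refl (d : ℕ) (t : GTree a V) : Red R d t t
  | step (d : ℕ) (s t : GTree a V) (p : Pos) : Step R p s.1 t.1 → d ≤ depth a p → Red R d s t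
  | lim (d : ℕ) (e : ℕ → ℕ) (f : ℕ → GTree a V) (T : GTree a V) : (∀ n, d ≤ e n) → Diverges e →
      (∀ n, Red R (e n) (f n) (f (n + 1))) → LimTo f T → Red R d (f 0) T

theorem Red.mono {d d' : ℕ} (hd : d ≤ d') {s t : GTree a V} (h : Red R d' s t) : Red R d s t := by
  cases h with
  | refl => exact .refl _ _
  | step _ _ _ p h h' => exact .step _ _ _ p h (hd.trans h')
  | lim _ e f _ h1 h2 h3 h4 => exact .lim _ e f _ (fun n => hd.trans (h1 n)) h2 h3 h4

theorem label_eq_of_chain {f : ℕ → GTree a V} {e : ℕ → ℕ}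
    (h : ∀ n p, depth a p < e n → (f n).1.label p = (f (n + 1)).1.label p) {p : Pos} {n m : ℕ}
    (hnm : n ≤ m) (hp : ∀ k ≥ n, depth a p < e k) : (f n).1.label p = (f m).1.label p := by
  induction m, hnm using Nat.le_induction with
  | base => rfl
  | succ m hm ih => rw [ih, h m p (hp m hm)]

theorem Red.label_eq {d : ℕ} {s t : GTree a V} (h : Red R d s t) :
    ∀ p, depth a p < d → s.1.label p = t.1.label p := by
  induction h with
  | refl => exact fun _ _ => rfl
  | step d s t p h h' => exact fun q hq => h.label_eq_of_depth_lt (hq.trans_le h')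
  | lim d e f T h1 _ _ h4 ih =>
    intro p hp
    obtain ⟨N, hN⟩ := h4 d
    rw [label_eq_of_chain ih (Nat.zero_le N) fun k _ => hp.trans_le (h1 k), hN N le_rfl p hp]

theorem Red.trans {d : ℕ} {s t w : GTree a V} (h : Red R d s t) (h' : Red R d t w) :
    Red R d s w := by
  -- Transitivity as a limit: the sequence `s, t, w, w, ...` has depth bound `d` for its two proper
  -- segments, and arbitrarily large bounds for the empty reductions from `w` on.
  refine .lim d (fun n => d + (n - 1)) (fun n => match n with
    | 0 => s
    | 1 => t
    | _ + 2 => w) w (fun n => Nat.le_add_right _ _) (fun m => ⟨m + 1, fun n hn => by dsimp only; omega⟩) ?_ ?_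
  · rintro (_ | _ | n)
    · exact h
    · exact h'
    · exact .refl _ _
  · refine fun d => ⟨2, fun n hn p hp => ?_⟩
    obtain ⟨n, rfl⟩ := Nat.exists_eq_add_of_le' hn
    rfl

/-- Labels at each depth are eventually constant. The limit is guarded because a branch whose depth
stays below `m` already lies in a tree of the sequence that agrees with the limit below depth `m`.
-/
theorem exists_limTo {f : ℕ → GTree a V} {e : ℕ → ℕ} (he : Diverges e)
    (h : ∀ n p, depth a p < e n → (f n).1.label p = (f (n + 1)).1.label p) :
    ∃ T, LimTo f T := by
  choose N hN using he
  let L : Pos → Option (Label V) := fun p => (f (N (depth a p + 1))).1.label p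
  have hL : ∀ d m, N d ≤ m → ∀ p, depth a p < d → (f m).1.label p = L p := by
    intro d m hm p hp
    rw [label_eq_of_chain h (le_max_left m (N (depth a p + 1)))
      (fun k hk => hp.trans_le (hN d k (hm.trans hk)))]
    exact (label_eq_of_chain h (le_max_right m (N (depth a p + 1))) fun k hk => hN _ k hk).symm
  have hL2 : ∀ p q, ∃ n, (f n).1.label p = L p ∧ (f n).1.label q = L q := fun p q =>
    ⟨N (max (depth a p) (depth a q) + 1), hL _ _ le_rfl p (by omega), hL _ _ le_rfl q (by omega)⟩
  let T : LTree V :=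
    { label := L
      lam_of_child := fun p hp => by
        obtain ⟨n, h1, h2⟩ := hL2 p (p ++ [0])
        rw [← h2] at hp
        rw [← h1, (f n).1.lam_of_child p hp]
      app_of_child := fun p i hi hp => by
        obtain ⟨n, h1, h2⟩ := hL2 p (p ++ [i])
        rw [← h2] at hp
        rw [← h1, (f n).1.app_of_child p i hi hp]
      binder := fun p q hp => by
        obtain ⟨n, h1, h2⟩ := hL2 p q
        rw [← h1] at hp
        rw [← h2]
        exact (f n).1.binder p q hp }
  refine ⟨⟨T, ?_⟩, fun d => ⟨N d, fun n hn p hp => hL d n hn p hp⟩⟩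
  rintro b hb ⟨m, hm⟩
  refine (f (N m)).2 b (fun k => ?_) ⟨m, hm⟩
  have := hb k
  rw [dom, Set.mem_ofPred_eq] at this ⊢
  rwa [hL m _ le_rfl _ (hm k)]

theorem LimTo.shift {f : ℕ → GTree a V} {T : GTree a V} (h : LimTo f T) (k : ℕ) :
    LimTo (fun n => f (k + n)) T := fun d =>
  let ⟨N, hN⟩ := h d
  ⟨N, fun n hn => hN (k + n) (by omega)⟩

theorem Diverges.shift {e : ℕ → ℕ} (h : Diverges e) (k : ℕ) : Diverges (fun n => e (k + n)) :=
  fun m => let ⟨N, hN⟩ := h m; ⟨N, fun n hn => hN (k + n) (by omega)⟩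

theorem Red.of_tail {d : ℕ} {f : ℕ → GTree a V} {e : ℕ → ℕ} {T : GTree a V} (he : Diverges e)
    (h : ∀ n, Red R (e n) (f n) (f (n + 1))) (hT : LimTo f T) (k : ℕ) (hd : ∀ n ≥ k, d ≤ e n) :
    Red R d (f k) T :=
  .lim d (fun n => e (k + n)) (fun n => f (k + n)) T (fun _ => hd _ (Nat.le_add_right _ _))
    (he.shift k) (fun n => h (k + n)) (hT.shift k)

theorem Red.of_chain {d : ℕ} {f : ℕ → GTree a V} (h : ∀ n, Red R d (f n) (f (n + 1))) (n : ℕ) :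
    Red R d (f 0) (f n) := by
  induction n with
  | zero => exact .refl _ _
  | succ n ih => exact ih.trans (h n)

/-! ### Reductions of ordinal length -/

open Order Ordinal

/-- `tr` and `pos` form a strongly `m`-convergent reduction of length `α` from `s` to `t` at
positions of depth at least `d`. -/
structure Realises (R : RewriteSystem.{u}) (d : ℕ) (s t : GTree a V) (α : Ordinal.{0})
    (tr : Ordinal.{0} → GTree a V) (pos : Ordinal.{0} → Pos) : Prop where
  zero : tr 0 = s
  last : tr α = t
  step : IsReduction R α tr pos
  depth_le : ∀ ι < α, d ≤ depth a (pos ι)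
  label_eq : ∀ ι ≤ α, ∀ p, depth a p < d → (tr ι).1.label p = s.1.label p
  conv : ∀ γ ≤ α, IsSuccLimit γ → ConvergesAt γ tr pos (tr γ)

/-- The concatenation of a sequence of reductions. -/
structure IsConcat (R : RewriteSystem.{u}) (α : ℕ → Ordinal.{0})
    (tr : ℕ → Ordinal.{0} → GTree a V) (pos : ℕ → Ordinal.{0} → Pos) (T : GTree a V)
    (σ : ℕ → Ordinal.{0}) (Λ : Ordinal.{0}) (TR : Ordinal.{0} → GTree a V)
    (POS : Ordinal.{0} → Pos) : Prop where
  zero : σ 0 = 0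
  succ : ∀ n, σ (n + 1) = σ n + α n
  isLUB : IsLUB (Set.range σ) Λ
  tr_eq : ∀ n, ∀ ι ≤ α n, TR (σ n + ι) = tr n ι
  pos_eq : ∀ n, ∀ ι < α n, POS (σ n + ι) = pos n ι
  last : (∀ n, σ n < Λ) → TR Λ = T
  exists_eq : ∀ ι < Λ, ∃ n, ∃ ι' < α n, ι = σ n + ι'
  step : IsReduction R Λ TR POS
  conv : ∀ γ n, γ ≤ σ n → IsSuccLimit γ → ConvergesAt γ TR POS (TR γ)

/-- This serves both convergent and destructive reductions. Hence no convergence is asserted at a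
`Λ` above all `σ n`: for a convergent reduction it follows from the divergence of `e`, and a
destructive one need not have it. -/
theorem exists_isConcat {e : ℕ → ℕ} {f : ℕ → GTree a V} {α : ℕ → Ordinal.{0}}
    {tr : ℕ → Ordinal.{0} → GTree a V} {pos : ℕ → Ordinal.{0} → Pos}
    (h : ∀ n, Realises R (e n) (f n) (f (n + 1)) (α n) (tr n) (pos n)) (T : GTree a V) :
    ∃ σ Λ TR POS, IsConcat R α tr pos T σ Λ TR POS := by
  classical
  let σ : ℕ → Ordinal.{0} := fun n => n.rec 0 fun n s => s + α n
  have hs : ∀ n, σ (n + 1) = σ n + α n := fun n => rfl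
  have hmono : Monotone σ := monotone_nat_of_le_succ fun n => by
    rw [hs]
    exact le_self_add
  let TR : Ordinal.{0} → GTree a V := fun ι =>
    if h : ∃ n, ι ≤ σ (n + 1) then tr (Nat.find h) (ι - σ (Nat.find h)) else T
  let POS : Ordinal.{0} → Pos := fun ι =>
    if h : ∃ n, ι < σ (n + 1) then pos (Nat.find h) (ι - σ (Nat.find h)) else []
  -- Segments may be empty, so one ordinal can be the boundary `σ n` for several `n`; the trees
  -- there coincide. This makes the choice of the least index in `TR` harmless.
  have hf : ∀ m n, m ≤ n → σ m = σ n → f m = f n := by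
    intro m n hmn
    induction n, hmn using Nat.le_induction with
    | base => exact fun _ => rfl
    | succ n hn ih =>
      intro hσ
      have h1 : σ m = σ n := le_antisymm (hmono hn) (hσ ▸ hmono (Nat.le_succ n))
      have h2 : α n = 0 := by
        have : σ n + α n = σ n + 0 := by rw [← hs, ← hσ, h1, add_zero]
        exact add_left_cancel this
      rw [ih h1, ← (h n).zero, ← (h n).last, h2]
  have hTR : ∀ n, ∀ ι ≤ α n, TR (σ n + ι) = tr n ι := by
    intro n ι hι
    have hex : ∃ m, σ n + ι ≤ σ (m + 1) := ⟨n, by rw [hs]; gcongr⟩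
    have hle : Nat.find hex ≤ n := Nat.find_min' hex (by rw [hs]; gcongr)
    have hval : TR (σ n + ι) = tr (Nat.find hex) (σ n + ι - σ (Nat.find hex)) := dif_pos hex
    have hspec := Nat.find_spec hex
    rw [hval]
    generalize Nat.find hex = m at hle hspec
    rcases hle.eq_or_lt with rfl | hlt
    · rw [Ordinal.add_sub_cancel]
    · have h1 : σ (m + 1) ≤ σ n := hmono hlt
      have h2 : σ n + ι = σ n + 0 := by
        rw [add_zero]
        exact le_antisymm (hspec.trans h1) le_self_add
      have h3 : ι = 0 := add_left_cancel h2
      subst h3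
      rw [add_zero] at hspec ⊢
      have h4 : σ (m + 1) = σ n := le_antisymm h1 hspec
      rw [← h4, hs, Ordinal.add_sub_cancel, (h m).last, (h n).zero]
      exact hf _ _ hlt h4
  have hPOS : ∀ n, ∀ ι < α n, POS (σ n + ι) = pos n ι := by
    intro n ι hι
    have hex : ∃ m, σ n + ι < σ (m + 1) := ⟨n, by rw [hs]; gcongr⟩
    have hle : Nat.find hex ≤ n := Nat.find_min' hex (by rw [hs]; gcongr)
    have hval : POS (σ n + ι) = pos (Nat.find hex) (σ n + ι - σ (Nat.find hex)) := dif_pos hex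
    have hspec := Nat.find_spec hex
    rw [hval]
    generalize Nat.find hex = m at hle hspec
    rcases hle.eq_or_lt with rfl | hlt
    · rw [Ordinal.add_sub_cancel]
    · have h1 : σ (m + 1) ≤ σ n := hmono hlt
      exact absurd (hspec.trans_le h1) (not_lt.2 le_self_add)
  have hdec : ∀ (ι : Ordinal.{0}) (n : ℕ), ι < σ n → ∃ m, ∃ ι' < α m, ι = σ m + ι' := by
    intro ι n
    induction n with
    | zero => exact fun h => absurd h (not_lt.2 zero_le)
    | succ n ih =>
      intro hn
      rcases lt_or_ge ι (σ n) with hlt | hlt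
      · exact ih hlt
      · have := Ordinal.add_sub_cancel_of_le hlt
        refine ⟨n, ι - σ n, ?_, this.symm⟩
        rw [hs, ← this] at hn
        exact lt_of_add_lt_add_left hn
  -- A boundary is assigned here to the segment that ends in it, so that a limit ordinal `γ` yields
  -- a limit ordinal `γ'` within that segment.
  have hdec' : ∀ (γ : Ordinal.{0}) (n : ℕ), 0 < γ → γ ≤ σ n → ∃ m γ', 0 < γ' ∧ γ' ≤ α m ∧ γ = σ m + γ' := by
    intro γ n h0
    induction n with
    | zero => exact fun h => absurd h0 (not_lt.2 h)
    | succ n ih =>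
      intro hn
      rcases le_or_gt γ (σ n) with hle | hle
      · exact ih hle
      · have := Ordinal.add_sub_cancel_of_le hle.le
        refine ⟨n, γ - σ n, ?_, ?_, this.symm⟩
        · rwa [Ordinal.lt_sub, add_zero]
        · rwa [Ordinal.sub_le, ← hs]
  have hlub : IsLUB (Set.range σ) (⨆ n, σ n) := isLUB_ciSup bddAbove_of_small
  refine ⟨σ, ⨆ n, σ n, TR, POS, rfl, hs, hlub, hTR, hPOS, ?_, ?_, ?_, ?_⟩
  · intro hlt
    have : ¬ ∃ n, (⨆ n, σ n) ≤ σ (n + 1) := fun ⟨n, hn⟩ => absurd (hlt (n + 1)) (not_lt.2 hn)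
    exact dif_neg this
  · intro ι hι
    obtain ⟨_, ⟨n, rfl⟩, hn⟩ := (lt_isLUB_iff hlub).1 hι
    exact hdec ι n hn
  · intro ι hι
    obtain ⟨_, ⟨n, rfl⟩, hn⟩ := (lt_isLUB_iff hlub).1 hι
    obtain ⟨m, ι', hι', rfl⟩ := hdec ι n hn
    have hsucc : Order.succ (σ m + ι') = σ m + Order.succ ι' := by
      simp only [Order.succ_eq_add_one, add_assoc]
    rw [hsucc, hTR m _ hι'.le, hTR m _ (Order.succ_le_of_lt hι'), hPOS m _ hι']
    exact (h m).step ι' hι'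
  · intro γ n hγ hlim d
    obtain ⟨m, γ', h0, hγ', rfl⟩ := hdec' γ n hlim.bot_lt hγ
    have hlim' : IsSuccLimit γ' := by
      rcases isSuccLimit_add_iff.1 hlim with h | ⟨h, -⟩
      · exact h
      · exact absurd h h0.ne'
    obtain ⟨β, hβ, hβ'⟩ := (h m).conv γ' hγ' hlim' d
    refine ⟨σ m + β, by gcongr, fun ι h1 h2 => ?_⟩
    have hι := Ordinal.add_sub_cancel_of_le (le_self_add.trans h1)
    rw [← hι] at h1 h2 ⊢
    have h3 := lt_of_add_lt_add_left h2
    rw [hPOS m _ (h3.trans_le hγ'), hTR m _ (h3.le.trans hγ'), hTR m _ hγ']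
    exact hβ' _ (le_of_add_le_add_left h1) h3

theorem not_isSuccLimit_of_le_one {γ : Ordinal.{0}} (h : γ ≤ 1) : ¬ IsSuccLimit γ := fun h' =>
  absurd ((omega0_le_of_isSuccLimit h').trans h) (not_le.2 one_lt_omega0)

theorem Red.exists_realises {d : ℕ} {s t : GTree a V} (h : Red R d s t) :
    ∃ α tr pos, Realises R d s t α tr pos := by
  induction h with
  | refl d t =>
    exact ⟨0, fun _ => t, fun _ => [], rfl, rfl, fun ι h => absurd h (not_lt.2 zero_le),
      fun ι h => absurd h (not_lt.2 zero_le), fun _ _ _ _ => rfl,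
      fun γ hγ hl => absurd hl (not_isSuccLimit_of_le_one (hγ.trans zero_le_one))⟩
  | step d s t p h h' =>
    classical
    refine ⟨1, fun ι => if ι = 0 then s else t, fun _ => p, if_pos rfl, if_neg one_ne_zero, ?_,
      fun _ _ => h', ?_, fun γ hγ hl => absurd hl (not_isSuccLimit_of_le_one hγ)⟩
    · intro ι hι
      obtain rfl := Order.lt_one_iff.1 hι
      simpa using h
    · intro ι _ q hq
      split_ifs
      · rfl
      · exact (h.label_eq_of_depth_lt (hq.trans_le h')).symm
  | lim d e f T h1 h2 h3 h4 ih =>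
    choose α tr pos h using ih
    obtain ⟨σ, Λ, TR, POS, hc⟩ := exists_isConcat h T
    have hlab : ∀ n m, n ≤ m → ∀ p, (∀ k ≥ n, depth a p < e k) →
        (f n).1.label p = (f m).1.label p := fun n m hnm p hp =>
      label_eq_of_chain (fun n => (h3 n).label_eq) hnm hp
    have hT : ∀ n p, (∀ k ≥ n, depth a p < e k) → (f n).1.label p = T.1.label p := by
      intro n p hp
      obtain ⟨N, hN⟩ := h4 (depth a p + 1)
      rw [hlab n (max n N) (le_max_left _ _) p hp, hN _ (le_max_right _ _) p (Nat.lt_succ_self _)]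
    have hmono : Monotone σ := monotone_nat_of_le_succ fun n => by
      rw [hc.succ]
      exact le_self_add
    have hσ0 : ∀ n, TR (σ n) = f n := fun n => by
      have := hc.tr_eq n 0 zero_le
      rwa [add_zero, (h n).zero] at this
    have hlast : TR Λ = T := by
      by_cases hlt : ∀ n, σ n < Λ
      · exact hc.last hlt
      · push Not at hlt
        obtain ⟨N, hN⟩ := hlt
        have hΛ : ∀ n ≥ N, σ n = Λ := fun n hn =>
          le_antisymm (hc.isLUB.1 ⟨n, rfl⟩) (hN.trans (hmono hn))
        rw [← hΛ N le_rfl, hσ0]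
        refine LimTo.unique (f := f) (fun d => ⟨N, fun n hn p _ => ?_⟩) h4
        rw [← hσ0 n, ← hσ0 N, hΛ n hn, hΛ N le_rfl]
    refine ⟨Λ, TR, POS, ?_, hlast, hc.step, ?_, ?_, ?_⟩
    · rw [← hσ0, hc.zero]
    · intro ι hι
      obtain ⟨n, ι', hι', rfl⟩ := hc.exists_eq ι hι
      rw [hc.pos_eq n _ hι']
      exact (h1 n).trans ((h n).depth_le _ hι')
    · intro ι hι p hp
      rcases hι.lt_or_eq with hι | rfl
      · obtain ⟨n, ι', hι', rfl⟩ := hc.exists_eq ι hι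
        rw [hc.tr_eq n _ hι'.le, (h n).label_eq _ hι'.le p (hp.trans_le (h1 n)),
          hlab 0 n (Nat.zero_le n) p fun k _ => hp.trans_le (h1 k)]
      · rw [hlast, hT 0 p fun k _ => hp.trans_le (h1 k)]
    · intro γ hγ hlim
      by_cases hex : ∃ n, γ ≤ σ n
      · obtain ⟨n, hn⟩ := hex
        exact hc.conv γ n hn hlim
      · push Not at hex
        obtain rfl : γ = Λ := le_antisymm hγ (hc.isLUB.2 (by rintro _ ⟨n, rfl⟩; exact (hex n).le))
        intro d
        obtain ⟨N, hN⟩ := h2 d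
        refine ⟨σ N, hex N, fun ι hι1 hι2 => ?_⟩
        obtain ⟨n, ι', hι', rfl⟩ := hc.exists_eq ι hι2
        -- An index from `σ N` on belongs to a segment `n ≥ N`, where the contractions have depth at
        -- least `e n ≥ d`.
        have hNn : N ≤ n := by
          by_contra hlt
          have h5 : σ (n + 1) ≤ σ N := hmono (by omega)
          rw [hc.succ] at h5
          exact absurd (h5.trans hι1) (not_le.2 (by gcongr))
        rw [hc.pos_eq n _ hι', hc.tr_eq n _ hι'.le, hlast]
        refine ⟨(hN n hNn).trans ((h n).depth_le _ hι'), fun p hp => ?_⟩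
        rw [(h n).label_eq _ hι'.le p (hp.trans_le (hN n hNn)),
          hT n p fun k hk => hp.trans_le (hN k (hNn.trans hk))]

theorem Red.exists_mConverges {d : ℕ} {s t : GTree a V} (h : Red R d s t) :
    ∃ α tr pos, tr 0 = s ∧ tr α = t ∧ MConverges R α tr pos := by
  obtain ⟨α, tr, pos, h⟩ := h.exists_realises
  refine ⟨α, tr, pos, h.zero, h.last, h.step, fun γ hγ hlim => ⟨(h.conv γ hγ hlim).hasLimit,
    fun d => ?_⟩⟩
  obtain ⟨β, hβ, hβ'⟩ := h.conv γ hγ hlim d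
  exact ⟨β, hβ, fun ι h1 h2 => (hβ' ι h1 h2).1⟩

/-! ### Fragile trees -/

theorem Realises.snoc {s t w : GTree a V} {α : Ordinal.{0}} {tr : Ordinal.{0} → GTree a V}
    {pos : Ordinal.{0} → Pos} (h : Realises R 0 s t α tr pos) {p : Pos} (hp : Step R p t.1 w.1) :
    ∃ tr' pos', Realises R 0 s w (Order.succ α) tr' pos' ∧ pos' α = p := by
  classical
  refine ⟨fun ι => if ι ≤ α then tr ι else w, fun ι => if ι < α then pos ι else p,
    ⟨?_, ?_, ?_, fun _ _ => Nat.zero_le _, fun _ _ _ h => absurd h (Nat.not_lt_zero _), ?_⟩, ?_⟩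
  · simp [h.zero]
  · exact if_neg (not_le.2 (Order.lt_succ α))
  · intro ι hι
    rcases (Order.lt_succ_iff.1 hι).lt_or_eq with hlt | rfl
    · simp only [hlt, hlt.le, if_true, Order.succ_le_of_lt hlt]
      exact h.step ι hlt
    · simpa [h.last] using hp
  · intro γ hγ hlim
    have hγα : γ ≤ α := by
      rcases hγ.lt_or_eq with hlt | rfl
      · exact Order.lt_succ_iff.1 hlt
      · exact absurd hlim (Order.not_isSuccLimit_succ α)
    intro d
    obtain ⟨β, hβ, hβ'⟩ := h.conv γ hγα hlim d
    refine ⟨β, hβ, fun ι h1 h2 => ?_⟩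
    simp only [h2.trans_le hγα, (h2.trans_le hγα).le, hγα, if_true]
    exact hβ' ι h1 h2
  · simp

/-- Concatenating the segments gives an open reduction, as none is empty. It is continuous below its
length since each segment converges strongly, and the last step of each segment makes the root
volatile. -/
theorem fragile_of_chain {u v : ℕ → GTree a V} {p : ℕ → Pos}
    (huv : ∀ n, Red betaRule 0 (u n) (v n))
    (hvu : ∀ n, Step betaRule (p n) (v n).1 (u (n + 1)).1) (hp : ∀ n, depth a (p n) = 0) :
    Fragile (u 0) := by
  choose α tr pos h using fun n => (huv n).exists_realises
  choose tr' pos' h' hpos using fun n => (h n).snoc (hvu n)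
  -- The final tree `u 0` is a dummy: a destructive reduction makes no claim about the tree at index
  -- `Λ`.
  obtain ⟨σ, Λ, TR, POS, hc⟩ := exists_isConcat h' (u 0)
  have hlt : ∀ n, σ n < Λ := fun n => by
    refine lt_of_lt_of_le ?_ (hc.isLUB.1 ⟨n + 1, rfl⟩)
    rw [hc.succ]
    exact lt_add_of_pos_right _ (Order.bot_lt_succ _)
  have hex : ∀ ι < Λ, ∃ n, ι < σ n := fun ι hι => by
    obtain ⟨_, ⟨n, rfl⟩, hn⟩ := (lt_isLUB_iff hc.isLUB).1 hι
    exact ⟨n, hn⟩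
  refine ⟨Λ, TR, POS, ?_, ?_, ⟨hc.step, fun ι => (TR ι).context (POS ι),
    fun ι hι => isRedContext_context (hc.step ι hι), fun γ hγ hlim => ?_⟩, ?_⟩
  · have := hc.tr_eq 0 0 zero_le
    rwa [hc.zero, add_zero, (h' 0).zero] at this
  · rw [Ordinal.isSuccLimit_iff, isSuccPrelimit_iff_succ_lt]
    refine ⟨(lt_of_le_of_lt zero_le (hlt 0)).ne', fun ι hι => ?_⟩
    obtain ⟨n, hn⟩ := hex ι hι
    exact (Order.succ_le_of_lt hn).trans_lt (hlt n)
  · obtain ⟨n, hn⟩ := hex γ hγ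
    exact (hc.conv γ n hn.le hlim).isLiminf
  · intro β hβ
    obtain ⟨n, hn⟩ := hex β hβ
    have hlast : POS (σ n + α n) = p n := by
      rw [hc.pos_eq n _ (Order.lt_succ (α n)), hpos]
    refine ⟨σ n + α n, hn.le.trans le_self_add, ?_, ?_, List.nil_prefix⟩
    · refine lt_of_lt_of_le ?_ (hc.isLUB.1 ⟨n + 1, rfl⟩)
      rw [hc.succ]
      gcongr
      exact Order.lt_succ (α n)
    · rw [hlast, cut_eq_nil (hp n)]

/-! ### Fragility of filled trees -/

theorem fragile_of_omega_at {u : GTree a V} {p : Pos} (hp : depth a p = 0)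
    (h : ∀ q, u.1.label (p ++ q) = ((omega V).label q).map (Label.shift p)) : Fragile u :=
  fragile_of_chain (u := fun _ => u) (v := fun _ => u) (p := fun _ => p)
    (fun _ => .refl _ _) (fun _ => step_beta_self h) fun _ => hp

/-- The tree `t` with `omega` at its `⊥`-positions. -/
noncomputable def GTree.fill (t : GTree a V) : GTree a V := ⟨t.1.fill, guarded_fill t.2⟩

/-- The empty tree. -/
def GTree.bot (a : Sig) (V : Type u) : GTree a V := ⟨LTree.bot V, guarded_bot a⟩

theorem omega_mem_fragileTotal (a : Sig) (V : Type u) : omega V ∈ fragileTotal a V := by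
  refine ⟨total_omega, ⟨omega V, guarded_omega a⟩, rfl,
    fragile_of_omega_at (p := []) (depth_nil a) fun q => ?_⟩
  have hs : (Label.shift [] : Label V → Label V) = id := by
    funext l
    cases l <;> rfl
  simp [hs]

theorem GTree.fragile_fill_of_botPos {t : GTree a V} {p : Pos} (h : t.1.BotPos p)
    (hp : depth a p = 0) : Fragile t.fill :=
  fragile_of_omega_at hp (fill_label_of_botPos h)

/-- The filled tree is itself the `⊥`-instance required by the rule, since `omega` is fragile and
total. -/
theorem GTree.step_bot {t : GTree a V} (h : Fragile t.fill) (ht : t ≠ GTree.bot a V) :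
    Step (bohmSystem (fragileTotal a)) [] t.1 (GTree.bot a V).1 := by
  refine .inr ⟨⟨t.1.fill, ⟨t.1.total_fill, fun p hp => ?_, fun p hp => ?_⟩, t.1.total_fill,
    t.fill, rfl, h⟩, fun h => ht (Subtype.ext h), rfl⟩
  · obtain ⟨l, hl⟩ := Option.ne_none_iff_exists'.1 hp
    rw [hl, sub_fill t.1 p l hl]
  · rw [subtree_fill hp]
    exact omega_mem_fragileTotal a _

/-- A reduction of `t` with respect to `β` and rules `t → ⊥` is simulated by a `β`-reduction of each
tree from which `t` is obtained by removing subtrees. -/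
theorem Red.exists_beta_of_sub {U : TreeSet.{u}} {d : ℕ} {s t : GTree a V}
    (h : Red (bohmSystem U) d s t) :
    ∀ u : GTree a V, s.1.Sub u.1 → ∃ u' : GTree a V, Red betaRule d u u' ∧ t.1.Sub u'.1 := by
  induction h with
  | refl => exact fun u hu => ⟨u, .refl _ _, hu⟩
  | step d s t p h h' =>
    intro u hu
    rcases h.beta_or_bot with h | h
    · obtain ⟨u', h1, h2⟩ := h.exists_of_sub u.1 hu
      exact ⟨⟨u', h1.guarded_of_beta u.2⟩, .step _ _ _ p h1 h', h2⟩
    -- A `⊥`-step only removes a subtree, so the simulating tree stays put.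
    · exact ⟨u, .refl _ _, h.sub_of_bot.trans hu⟩
  | lim d e f T h1 h2 _ h4 ih =>
    intro u hu
    have : Nonempty (GTree a V) := ⟨u⟩
    choose! g hg1 hg2 using ih
    let w : ℕ → GTree a V := fun n => n.rec u g
    have hw : ∀ n, (f n).1.Sub (w n).1 := by
      intro n
      induction n with
      | zero => exact hu
      | succ n ih => exact hg2 n _ ih
    have hw' : ∀ n, Red betaRule (e n) (w n) (w (n + 1)) := fun n => hg1 n _ (hw n)
    -- The simulation keeps the depth bounds `e n`, so it converges as well.
    obtain ⟨u', hu'⟩ := exists_limTo h2 fun n => (hw' n).label_eq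
    refine ⟨u', .lim d e w u' h1 h2 hw' hu', fun p l hl => ?_⟩
    obtain ⟨N, hN⟩ := h4 (depth a p + 1)
    obtain ⟨N', hN'⟩ := hu' (depth a p + 1)
    rw [← hN' (max N N') (le_max_right _ _) p (Nat.lt_succ_self _)]
    rw [← hN (max N N') (le_max_left _ _) p (Nat.lt_succ_self _)] at hl
    exact hw _ p l hl

/-! ### Stability -/

/-- All steps in reductions from `s` are at positions of depth at least `d`. -/
def Stable (R : RewriteSystem.{u}) (d : ℕ) (s : GTree a V) : Prop :=
  ∀ t, Red R 0 s t → ∀ (p : Pos) (t' : GTree a V), Step R p t.1 t'.1 → d ≤ depth a p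

theorem Stable.red {d : ℕ} {s t : GTree a V} (hs : Stable R d s) (h : Red R 0 s t) :
    Stable R d t := fun _ h' => hs _ (h.trans h')

theorem Stable.mono {d d' : ℕ} (hd : d ≤ d') {s : GTree a V} (h : Stable R d' s) : Stable R d s :=
  fun t h1 p t' h2 => hd.trans (h t h1 p t' h2)

/-- Each contraction in the reduction starts from a reduct of `s`, so stability bounds its depth.
Retaining `e` in the maximum keeps the divergence needed at limits. -/
theorem Red.max_of_stable {d e : ℕ} {s t : GTree a V} (h : Red R e s t) :
    Stable R d s → Red R (max d e) s t := by
  induction h with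
  | refl => exact fun _ => .refl _ _
  | step e s t p h h' => exact fun hs => .step _ _ _ p h (max_le (hs s (.refl _ _) p t h) h')
  | lim e e' f T h1 h2 h3 h4 ih =>
    intro hs
    refine .lim _ (fun n => max d (e' n)) f T (fun n => max_le_max le_rfl (h1 n))
      (fun m => ?_) (fun n => ih n (hs.red (Red.of_chain (fun n => (h3 n).mono (Nat.zero_le _)) n)))
      h4
    obtain ⟨N, hN⟩ := h2 m
    exact ⟨N, fun n hn => (hN n hn).trans (le_max_right _ _)⟩

theorem Red.of_stable {d : ℕ} {s t : GTree a V} (h : Red R 0 s t) (hs : Stable R d s) :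
    Red R d s t := (h.max_of_stable hs).mono (le_max_left _ _)

theorem Red.eq_of_forall_not_step {d : ℕ} {s t : GTree a V} (h : Red R d s t) :
    (∀ (p : Pos) (t' : GTree a V), ¬ Step R p s.1 t'.1) → t = s := by
  induction h with
  | refl => exact fun _ => rfl
  | step d s t p h h' => exact fun hs => absurd h (hs p t)
  | lim d e f T h1 h2 h3 h4 ih =>
    intro hs
    have hf : ∀ n, f n = f 0 := by
      intro n
      induction n with
      | zero => rfl
      | succ n ihn => rw [ih n (by rwa [ihn]), ihn]
    exact h4.unique fun d => ⟨0, fun n _ p _ => by rw [hf n]⟩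

theorem stable_of_forall_not_step (d : ℕ) {s : GTree a V}
    (hs : ∀ (p : Pos) (t' : GTree a V), ¬ Step R p s.1 t'.1) : Stable R d s := by
  intro t h p t' h'
  rw [h.eq_of_forall_not_step hs] at h'
  exact absurd h' (hs p t')

/-! ### The first stage: stability up to depth one. -/

theorem not_step_bot {U : TreeSet.{u}} (p : Pos) (t : LTree V) :
    ¬ Step (bohmSystem U) p (LTree.bot V) t := by
  intro h
  have hlab : ∀ s : LTree V, Step (bohmSystem U) p s t → s ≠ LTree.bot V := by
    rintro s h rfl
    rcases p with _ | ⟨i, p⟩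
    · rcases h with ⟨r, w, h, -⟩ | ⟨-, h, -⟩
      · exact app_ne_bot _ _ h.symm
      · exact h rfl
    · rcases h with ⟨-, r, r', h, -⟩ | ⟨-, r, r', w, h, -⟩ | ⟨-, r, r', w, h, -⟩
      · exact abs_ne_bot _ h.symm
      · exact app_ne_bot _ _ h.symm
      · exact app_ne_bot _ _ h.symm
  exact hlab _ h rfl

/-- Each guarded tree reduces to a tree that allows no further step at depth zero. -/
theorem exists_red_stable_one (t : GTree a V) :
    ∃ t', Red (bohmSystem (fragileTotal a)) 0 t t' ∧
      Stable (bohmSystem (fragileTotal a)) 1 t' := by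
  by_contra hcon
  push Not at hcon
  have hbot : ∀ r, Red (bohmSystem (fragileTotal a)) 0 t r → r ≠ GTree.bot a V := by
    rintro _ h rfl
    exact hcon _ h (stable_of_forall_not_step 1 fun p t' => not_step_bot p t'.1)
  -- Otherwise `r`, and hence `t`, would reduce to `⊥`.
  have hfrag : ∀ r, Red (bohmSystem (fragileTotal a)) 0 t r → ¬ Fragile r.fill := by
    intro r h hr
    have hstep := GTree.step_bot hr (hbot r h)
    exact hbot _ (h.trans (.step 0 _ _ [] hstep (Nat.zero_le _))) rfl
  have hnext : ∀ r, Red (bohmSystem (fragileTotal a)) 0 t r →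
      ∀ u : GTree a V, r.1.Sub u.1 → ∃ (p : Pos) (v u' r' : GTree a V),
        depth a p = 0 ∧ Red betaRule 0 u v ∧ Step betaRule p v.1 u'.1 ∧
        Red (bohmSystem (fragileTotal a)) 0 t r' ∧ r'.1.Sub u'.1 := by
    intro r h u hu
    have hns := hcon r h
    unfold Stable at hns
    push Not at hns
    obtain ⟨r₁, h1, p, r₂, h2, hp⟩ := hns
    have hp0 : depth a p = 0 := by omega
    have h3 := (h.trans h1).trans (.step 0 _ _ p h2 (Nat.zero_le _))
    rcases h2.beta_or_bot with h2 | h2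
    · obtain ⟨v, hv, hv'⟩ := h1.exists_beta_of_sub u hu
      obtain ⟨u', hu', hu''⟩ := h2.exists_of_sub v.1 hv'
      exact ⟨p, v, ⟨u', hu'.guarded_of_beta v.2⟩, r₂, hp0, hv, hu', h3, hu''⟩
    -- After a `⊥`-step at depth zero the filled tree would loop at that position.
    · exact absurd (GTree.fragile_fill_of_botPos h2.botPos_of_bot hp0) (hfrag _ h3)
  -- The states of the simulation: a reduct of `t`, and a tree on the `β`-side that contains it.
  let X := {x : GTree a V × GTree a V //
    Red (bohmSystem (fragileTotal a)) 0 t x.1 ∧ x.1.1.Sub x.2.1}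
  have hX : ∀ x : X, ∃ (p : Pos) (v : GTree a V) (y : X), depth a p = 0 ∧
      Red betaRule 0 x.1.2 v ∧ Step betaRule p v.1 y.1.2.1 := by
    rintro ⟨⟨r, u⟩, hr, hu⟩
    obtain ⟨p, v, u', r', h1, h2, h3, h4, h5⟩ := hnext r hr u hu
    exact ⟨p, v, ⟨⟨r', u'⟩, h4, h5⟩, h1, h2, h3⟩
  choose p v next h1 h2 h3 using hX
  let x : ℕ → X := fun n => n.rec ⟨⟨t, t.fill⟩, .refl _ _, sub_fill t.1⟩ fun _ => next
  exact hfrag t (.refl _ _) (fragile_of_chain (u := fun n => (x n).1.2) (v := fun n => v (x n))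
    (p := fun n => p (x n)) (fun n => h2 (x n)) (fun n => h3 (x n)) fun n => h1 (x n))

/-! ### Reductions below the root -/

/-- The abstraction of a guarded tree. -/
def GTree.abs (r : GTree a (Option V)) : GTree a V := ⟨r.1.abs, guarded_abs.2 r.2⟩

/-- The application of guarded trees. -/
def GTree.app (r w : GTree a V) : GTree a V := ⟨r.1.app w.1, guarded_app.2 ⟨r.2, w.2⟩⟩

theorem GTree.abs_injective : Function.Injective (GTree.abs : GTree a (Option V) → GTree a V) :=
  fun _ _ h => Subtype.ext (LTree.abs_injective (congrArg Subtype.val h))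

theorem GTree.app_inj {r r' w w' : GTree a V} : r.app w = r'.app w' ↔ r = r' ∧ w = w' := by
  refine ⟨fun h => ?_, by rintro ⟨rfl, rfl⟩; rfl⟩
  have := LTree.app_inj.1 (congrArg Subtype.val h)
  exact ⟨Subtype.ext this.1, Subtype.ext this.2⟩

theorem agree_abs {r r' : LTree (Option V)} {D : ℕ}
    (h : ∀ p, (a 0 : ℕ) + depth a p < D → r.label p = r'.label p) :
    ∀ p, depth a p < D → (r.abs).label p = (r'.abs).label p := by
  rintro (_ | ⟨i, p⟩) hp
  · rfl
  · by_cases hi : i = 0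
    · subst hi
      rw [abs_label_cons, abs_label_cons, h p (by rwa [depth_cons] at hp)]
    · rw [abs_label_cons_ne _ hi, abs_label_cons_ne _ hi]

theorem agree_app {r r' w w' : LTree V} {D : ℕ}
    (h1 : ∀ p, (a 1 : ℕ) + depth a p < D → r.label p = r'.label p)
    (h2 : ∀ p, (a 2 : ℕ) + depth a p < D → w.label p = w'.label p) :
    ∀ p, depth a p < D → (r.app w).label p = (r'.app w').label p := by
  rintro (_ | ⟨i, p⟩) hp
  · rfl
  · rw [depth_cons] at hp
    fin_cases i
    · rfl
    · simp only [Fin.mk_one, app_label_cons_one]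
      rw [h1 p hp]
    · simp only [Fin.reduceFinMk, app_label_cons_two]
      rw [h2 p hp]

theorem LimTo.abs {f : ℕ → GTree a (Option V)} {T : GTree a (Option V)} (h : LimTo f T) :
    LimTo (fun n => (f n).abs) T.abs := fun d =>
  let ⟨N, hN⟩ := h d
  ⟨N, fun n hn => agree_abs fun p hp => hN n hn p (by omega)⟩

theorem LimTo.app {f g : ℕ → GTree a V} {T T' : GTree a V} (h : LimTo f T) (h' : LimTo g T') :
    LimTo (fun n => (f n).app (g n)) (T.app T') := fun d =>
  let ⟨N, hN⟩ := h d
  let ⟨N', hN'⟩ := h' d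
  ⟨max N N', fun n hn => agree_app (fun p hp => hN n (le_of_max_le_left hn) p (by omega))
    (fun p hp => hN' n (le_of_max_le_right hn) p (by omega))⟩

theorem limTo_const (t : GTree a V) : LimTo (fun _ => t) t := fun _ => ⟨0, fun _ _ _ _ => rfl⟩

theorem Diverges.add_const {e : ℕ → ℕ} (h : Diverges e) (k : ℕ) : Diverges (fun n => e n + k) :=
  fun m => let ⟨N, hN⟩ := h m; ⟨N, fun n hn => (hN n hn).trans (Nat.le_add_right _ _)⟩

theorem Diverges.sub_const {e : ℕ → ℕ} (h : Diverges e) (k : ℕ) : Diverges (fun n => e n - k) :=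
  fun m => let ⟨N, hN⟩ := h (m + k); ⟨N, fun n hn => Nat.le_sub_of_add_le (hN n hn)⟩

theorem Red.abs {d : ℕ} {r r' : GTree a (Option V)} (h : Red R d r r') :
    Red R (d + a 0) r.abs r'.abs := by
  induction h with
  | refl => exact .refl _ _
  | step d s t p h h' =>
    exact .step _ _ _ (0 :: p) (step_cons_zero.2 ⟨_, _, rfl, rfl, h⟩)
      (by rw [depth_cons]; omega)
  | lim d e f T h1 h2 h3 h4 ih =>
    exact .lim _ (fun n => e n + a 0) (fun n => (f n).abs) T.abs
      (fun n => Nat.add_le_add_right (h1 n) _) (h2.add_const _) ih h4.abs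

theorem Red.app_left {d : ℕ} {r r' : GTree a V} (h : Red R d r r') (w : GTree a V) :
    Red R (d + a 1) (r.app w) (r'.app w) := by
  induction h with
  | refl => exact .refl _ _
  | step d s t p h h' =>
    exact .step _ _ _ (1 :: p) (step_cons_one.2 ⟨_, _, _, rfl, rfl, h⟩)
      (by rw [depth_cons]; omega)
  | lim d e f T h1 h2 h3 h4 ih =>
    exact .lim _ (fun n => e n + a 1) (fun n => (f n).app w) (T.app w)
      (fun n => Nat.add_le_add_right (h1 n) _) (h2.add_const _) ih (h4.app (limTo_const w))

theorem Red.app_right {d : ℕ} {r r' : GTree a V} (h : Red R d r r') (w : GTree a V) :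
    Red R (d + a 2) (w.app r) (w.app r') := by
  induction h with
  | refl => exact .refl _ _
  | step d s t p h h' =>
    exact .step _ _ _ (2 :: p) (step_cons_two.2 ⟨_, _, _, rfl, rfl, h⟩)
      (by rw [depth_cons]; omega)
  | lim d e f T h1 h2 h3 h4 ih =>
    exact .lim _ (fun n => e n + a 2) (fun n => w.app (f n)) (w.app T)
      (fun n => Nat.add_le_add_right (h1 n) _) (h2.add_const _) ih ((limTo_const w).app h4)

theorem Stable.not_rule {s t : GTree a V} (h : Stable R 1 s) : ¬ R V s.1 t.1 := fun h' =>
  absurd (h s (.refl _ _) [] t h') (by simp [depth_nil])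

/-- Stability up to depth one excludes root steps, so every step takes place in the body, at a depth
smaller by `a 0`. This shift by a constant preserves divergence, so the bodies converge too. -/
theorem Red.exists_of_abs {d : ℕ} {s t : GTree a V} (h : Red R d s t) :
    Stable R 1 s → ∀ r, s = GTree.abs r → ∃ r', t = GTree.abs r' ∧ Red R (d - a 0) r r' := by
  induction h with
  | refl => exact fun _ r hr => ⟨r, hr, .refl _ _⟩
  | step d s t p h h' =>
    intro hs r hr
    rcases p with _ | ⟨i, p⟩
    · exact absurd h hs.not_rule
    · subst hr
      rcases h with ⟨rfl, r₁, r', h1, h2, h3⟩ | ⟨-, _, _, _, h1, -⟩ | ⟨-, _, _, _, h1, -⟩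
      · obtain rfl : r.1 = r₁ := LTree.abs_injective h1
        refine ⟨⟨r', guarded_abs.1 (h2 ▸ t.2)⟩, Subtype.ext h2, .step _ _ _ p h3 ?_⟩
        rw [depth_cons] at h'
        omega
      · exact absurd h1 (abs_ne_app _ _ _)
      · exact absurd h1 (abs_ne_app _ _ _)
  | lim d e f T h1 h2 h3 h4 ih =>
    intro hs r hr
    have hst : ∀ n, Stable R 1 (f n) := fun n =>
      hs.red (Red.of_chain (fun n => (h3 n).mono (Nat.zero_le _)) n)
    have hex : ∀ n, ∃ g, f n = GTree.abs g := by
      intro n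
      induction n with
      | zero => exact ⟨r, hr⟩
      | succ n ihn =>
        obtain ⟨g, hg⟩ := ihn
        obtain ⟨g', hg', -⟩ := ih n (hst n) g hg
        exact ⟨g', hg'⟩
    choose g hg using hex
    obtain rfl : g 0 = r := GTree.abs_injective ((hg 0).symm.trans hr)
    have hred : ∀ n, Red R (e n - a 0) (g n) (g (n + 1)) := by
      intro n
      obtain ⟨g', hg', hr'⟩ := ih n (hst n) (g n) (hg n)
      rwa [GTree.abs_injective ((hg (n + 1)).symm.trans hg')]
    obtain ⟨T', hT'⟩ := exists_limTo (h2.sub_const (a 0)) fun n => (hred n).label_eq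
    refine ⟨T', h4.unique ?_, .lim _ (fun n => e n - a 0) g T'
      (fun n => Nat.sub_le_sub_right (h1 n) _) (h2.sub_const _) hred hT'⟩
    rw [funext hg]
    exact hT'.abs

theorem Red.exists_of_app {d : ℕ} {s t : GTree a V} (h : Red R d s t) :
    Stable R 1 s → ∀ r w, s = GTree.app r w →
      ∃ r' w', t = GTree.app r' w' ∧ Red R (d - a 1) r r' ∧ Red R (d - a 2) w w' := by
  induction h with
  | refl => exact fun _ r w hr => ⟨r, w, hr, .refl _ _, .refl _ _⟩
  | step d s t p h h' =>
    intro hs r w hr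
    rcases p with _ | ⟨i, p⟩
    · exact absurd h hs.not_rule
    · subst hr
      rw [depth_cons] at h'
      rcases h with ⟨-, r₁, r', h1, -⟩ | ⟨rfl, r₁, r', w', h1, h2, h3⟩ |
        ⟨rfl, w₁, w', r', h1, h2, h3⟩
      · exact absurd h1.symm (abs_ne_app _ _ _)
      · obtain ⟨rfl, rfl⟩ := LTree.app_inj.1 h1
        exact ⟨⟨r', (guarded_app.1 (h2 ▸ t.2)).1⟩, w, Subtype.ext h2,
          .step _ _ _ p h3 (by omega), .refl _ _⟩
      · obtain ⟨rfl, rfl⟩ := LTree.app_inj.1 h1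
        exact ⟨r, ⟨w', (guarded_app.1 (h2 ▸ t.2)).2⟩, Subtype.ext h2, .refl _ _,
          .step _ _ _ p h3 (by omega)⟩
  | lim d e f T h1 h2 h3 h4 ih =>
    intro hs r w hr
    have hst : ∀ n, Stable R 1 (f n) := fun n =>
      hs.red (Red.of_chain (fun n => (h3 n).mono (Nat.zero_le _)) n)
    have hex : ∀ n, ∃ g k, f n = GTree.app g k := by
      intro n
      induction n with
      | zero => exact ⟨r, w, hr⟩
      | succ n ihn =>
        obtain ⟨g, k, hg⟩ := ihn
        obtain ⟨g', k', hg', -⟩ := ih n (hst n) g k hg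
        exact ⟨g', k', hg'⟩
    choose g k hg using hex
    obtain ⟨rfl, rfl⟩ : g 0 = r ∧ k 0 = w := GTree.app_inj.1 ((hg 0).symm.trans hr)
    have hred : ∀ n, Red R (e n - a 1) (g n) (g (n + 1)) ∧ Red R (e n - a 2) (k n) (k (n + 1)) := by
      intro n
      obtain ⟨g', k', hg', hr'⟩ := ih n (hst n) (g n) (k n) (hg n)
      obtain ⟨h5, h6⟩ := GTree.app_inj.1 ((hg (n + 1)).symm.trans hg')
      rwa [h5, h6]
    obtain ⟨T₁, hT₁⟩ := exists_limTo (h2.sub_const (a 1)) fun n => (hred n).1.label_eq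
    obtain ⟨T₂, hT₂⟩ := exists_limTo (h2.sub_const (a 2)) fun n => (hred n).2.label_eq
    refine ⟨T₁, T₂, h4.unique ?_,
      .lim _ (fun n => e n - a 1) g T₁ (fun n => Nat.sub_le_sub_right (h1 n) _) (h2.sub_const _)
        (fun n => (hred n).1) hT₁,
      .lim _ (fun n => e n - a 2) k T₂ (fun n => Nat.sub_le_sub_right (h1 n) _) (h2.sub_const _)
        (fun n => (hred n).2) hT₂⟩
    rw [funext hg]
    exact hT₁.app hT₂

theorem Stable.of_abs {d : ℕ} {r : GTree a (Option V)} (h : Stable R d r.abs) :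
    Stable R (d - a 0) r := by
  intro t ht p t' h'
  have := h t.abs (ht.abs.mono (Nat.zero_le _)) (0 :: p) t'.abs
    (step_cons_zero.2 ⟨_, _, rfl, rfl, h'⟩)
  rw [depth_cons] at this
  omega

theorem Stable.of_app_left {d : ℕ} {r w : GTree a V} (h : Stable R d (r.app w)) :
    Stable R (d - a 1) r := by
  intro t ht p t' h'
  have := h (t.app w) ((ht.app_left w).mono (Nat.zero_le _)) (1 :: p) (t'.app w)
    (step_cons_one.2 ⟨_, _, _, rfl, rfl, h'⟩)
  rw [depth_cons] at this
  omega

theorem Stable.of_app_right {d : ℕ} {r w : GTree a V} (h : Stable R d (r.app w)) :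
    Stable R (d - a 2) w := by
  intro t ht p t' h'
  have := h (r.app t) ((ht.app_right r).mono (Nat.zero_le _)) (2 :: p) (r.app t')
    (step_cons_two.2 ⟨_, _, _, rfl, rfl, h'⟩)
  rw [depth_cons] at this
  omega

/-- The hypothesis `h1` keeps the root from being contracted, after which stability can be checked
in the body. -/
theorem Stable.abs {d : ℕ} {r : GTree a (Option V)} (h1 : Stable R 1 r.abs)
    (h : Stable R (d - a 0) r) : Stable R d r.abs := by
  intro t ht p t' h'
  have hst := h1.red ht
  obtain ⟨r', rfl, hr'⟩ := ht.exists_of_abs h1 r rfl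
  rcases p with _ | ⟨i, p⟩
  · exact absurd h' hst.not_rule
  · rcases h' with ⟨rfl, r₁, r₂, h2, h3, h4⟩ | ⟨-, _, _, _, h2, -⟩ | ⟨-, _, _, _, h2, -⟩
    · obtain rfl : r'.1 = r₁ := LTree.abs_injective h2
      have := h r' (hr'.mono (Nat.zero_le _)) p ⟨r₂, guarded_abs.1 (h3 ▸ t'.2)⟩ h4
      rw [depth_cons]
      omega
    · exact absurd h2 (abs_ne_app _ _ _)
    · exact absurd h2 (abs_ne_app _ _ _)

theorem Stable.app {d : ℕ} {r w : GTree a V} (h1 : Stable R 1 (r.app w))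
    (hr : Stable R (d - a 1) r) (hw : Stable R (d - a 2) w) : Stable R d (r.app w) := by
  intro t ht p t' h'
  have hst := h1.red ht
  obtain ⟨r', w', rfl, hr', hw'⟩ := ht.exists_of_app h1 r w rfl
  rcases p with _ | ⟨i, p⟩
  · exact absurd h' hst.not_rule
  · rw [depth_cons]
    rcases h' with ⟨-, _, _, h2, -⟩ | ⟨rfl, r₁, r₂, w₁, h2, h3, h4⟩ | ⟨rfl, w₁, w₂, r₁, h2, h3, h4⟩
    · exact absurd h2.symm (abs_ne_app _ _ _)
    · obtain ⟨rfl, rfl⟩ := LTree.app_inj.1 h2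
      have := hr r' (hr'.mono (Nat.zero_le _)) p ⟨r₂, (guarded_app.1 (h3 ▸ t'.2)).1⟩ h4
      omega
    · obtain ⟨rfl, rfl⟩ := LTree.app_inj.1 h2
      have := hw w' (hw'.mono (Nat.zero_le _)) p ⟨w₂, (guarded_app.1 (h3 ▸ t'.2)).2⟩ h4
      omega

/-! ### Increasing the stable depth, and the normal form as a limit. -/

theorem GTree.cases_root (t : GTree a V) :
    t = GTree.bot a V ∨ (∃ x, t.1 = var x) ∨ (∃ r, t = GTree.abs r) ∨ ∃ r w, t = GTree.app r w := by
  rcases t.1.cases_root with h | h | ⟨r, h⟩ | ⟨r, w, h⟩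
  · exact .inl (Subtype.ext h)
  · exact .inr (.inl h)
  · exact .inr (.inr (.inl ⟨⟨r, guarded_abs.1 (h ▸ t.2)⟩, Subtype.ext h⟩))
  · have := guarded_app.1 (h ▸ t.2)
    exact .inr (.inr (.inr ⟨⟨r, this.1⟩, ⟨w, this.2⟩, Subtype.ext h⟩))

/-- Each tree that is stable up to depth `d` reduces to one that is stable up to depth `d + 1`. -/
theorem Stable.exists_red_succ (d : ℕ) : ∀ {V : Type u} {t : GTree a V},
    Stable (bohmSystem (fragileTotal a)) d t →
    ∃ t', Red (bohmSystem (fragileTotal a)) d t t' ∧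
      Stable (bohmSystem (fragileTotal a)) (d + 1) t' := by
  induction d with
  | zero => exact fun {V t} _ => exists_red_stable_one t
  | succ d ihd =>
    -- Inner induction on a strict bound `N` for the lengths of positions of depth zero. At a strict
    -- child `N` drops and the depth stays; at a non-strict child the outer hypothesis applies and
    -- no length bound is needed.
    suffices key : ∀ (N : ℕ) {V : Type u} {t : GTree a V},
        (∀ p, t.1.label p ≠ none → depth a p = 0 → p.length < N) →
        Stable (bohmSystem (fragileTotal a)) (d + 1) t →
        ∃ t', Red (bohmSystem (fragileTotal a)) (d + 1) t t' ∧
          Stable (bohmSystem (fragileTotal a)) (d + 1 + 1) t' by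
      intro V t ht
      obtain ⟨N, hN⟩ := t.2.exists_bound
      exact key N hN ht
    intro N
    induction N with
    | zero =>
      intro V t hN _
      obtain rfl : t = GTree.bot a V := Subtype.ext (t.1.eq_bot_of_label (by
        by_contra h
        exact absurd (hN [] h (depth_nil a)) (Nat.not_lt_zero _)))
      exact ⟨_, .refl _ _, stable_of_forall_not_step _ fun p t' => not_step_bot p t'.1⟩
    | succ N ihN =>
      have child : ∀ {W : Type u} (i : Fin 3) (r : GTree a W),
          ((a i : ℕ) = 0 → ∀ p, r.1.label p ≠ none → depth a p = 0 → p.length < N) →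
          Stable (bohmSystem (fragileTotal a)) (d + 1 - a i) r →
          ∃ r', Red (bohmSystem (fragileTotal a)) (d + 1 - a i) r r' ∧
            Stable (bohmSystem (fragileTotal a)) (d + 1 + 1 - a i) r' := by
        intro W i r hr hst
        obtain hi | hi : (a i : ℕ) = 0 ∨ (a i : ℕ) = 1 := by omega
        · rw [hi] at hst ⊢
          exact ihN (hr hi) hst
        · rw [hi] at hst ⊢
          exact ihd hst
      intro V t hN ht
      have ht1 := ht.mono (Nat.le_add_left 1 d)
      rcases t.cases_root with rfl | ⟨x, hx⟩ | ⟨r, rfl⟩ | ⟨r, w, rfl⟩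
      · exact ⟨_, .refl _ _, stable_of_forall_not_step _ fun p t' => not_step_bot p t'.1⟩
      · refine ⟨t, .refl _ _, stable_of_forall_not_step _ fun p t' h => ?_⟩
        rcases p with _ | ⟨i, p⟩
        · exact ht1.not_rule h
        · rw [hx] at h
          rcases h with ⟨-, _, _, h, -⟩ | ⟨-, _, _, _, h, -⟩ | ⟨-, _, _, _, h, -⟩
          · exact abs_ne_var _ _ h.symm
          · exact app_ne_var _ _ _ h.symm
          · exact app_ne_var _ _ _ h.symm
      · obtain ⟨r', h1, h2⟩ := child 0 r (fun h0 p hp hp0 => by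
          have := hN (0 :: p) (by simpa [GTree.abs, abs_label_cons] using hp)
            (by rw [depth_cons]; omega)
          simpa using this) ht.of_abs
        have h3 : Red _ 0 r.abs r'.abs := h1.abs.mono (Nat.zero_le _)
        -- The depth bound of the lifted reduction is recovered from the stability of the source.
        exact ⟨r'.abs, h3.of_stable ht, (ht1.red h3).abs h2⟩
      · obtain ⟨r', h1, h2⟩ := child 1 r (fun h0 p hp hp0 => by
          have := hN (1 :: p) (by simpa [GTree.app, app_label_cons_one] using hp)
            (by rw [depth_cons]; omega)
          simpa using this) ht.of_app_left
        obtain ⟨w', h3, h4⟩ := child 2 w (fun h0 p hp hp0 => by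
          have := hN (2 :: p) (by simpa [GTree.app, app_label_cons_two] using hp)
            (by rw [depth_cons]; omega)
          simpa using this) ht.of_app_right
        have h5 : Red _ 0 (r.app w) (r'.app w') :=
          ((h1.app_left w).mono (Nat.zero_le _)).trans ((h3.app_right r').mono (Nat.zero_le _))
        exact ⟨r'.app w', h5.of_stable ht, (ht1.red h5).app h2 h4⟩

theorem exists_red_isNormalForm (s : GTree a V) :
    ∃ t, Red (bohmSystem (fragileTotal a)) 0 s t ∧
      IsNormalForm a (bohmSystem (fragileTotal a)) t := by
  have : Nonempty (GTree a V) := ⟨s⟩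
  choose! next h1 h2 using fun d (t : GTree a V) => Stable.exists_red_succ (a := a) d (t := t)
  let f : ℕ → GTree a V := fun n => n.rec s next
  have hf : ∀ n, Stable (bohmSystem (fragileTotal a)) n (f n) := by
    intro n
    induction n with
    | zero => exact fun _ _ _ _ _ => Nat.zero_le _
    | succ n ih => exact h2 n _ ih
  have hred : ∀ n, Red (bohmSystem (fragileTotal a)) n (f n) (f (n + 1)) := fun n => h1 n _ (hf n)
  have hdiv : Diverges fun n => n := fun m => ⟨m, fun _ h => h⟩
  obtain ⟨T, hT⟩ := exists_limTo hdiv fun n => (hred n).label_eq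
  refine ⟨T, .lim 0 _ f T (fun _ => Nat.zero_le _) hdiv hred hT, ?_⟩
  rintro ⟨p, T', h⟩
  -- The limit is a reduct of the tree at stage `depth a p + 1`, whose stability forbids a step at
  -- `p`.
  have := hf (depth a p + 1) T (Red.of_tail hdiv hred hT (depth a p + 1) fun _ _ => Nat.zero_le _) p T' h
  omega

end InfLam

theorem mainTheorem9 (a : InfLam.Sig) (V : Type) [Countable V] [Infinite V]
    (s : InfLam.GTree a V) :
    ∃ (α : Ordinal.{0}) (tr : Ordinal.{0} → InfLam.GTree a V) (pos : Ordinal.{0} → InfLam.Pos),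
      tr 0 = s ∧
      InfLam.MConverges (InfLam.bohmSystem (InfLam.fragileTotal a)) α tr pos ∧
      InfLam.IsNormalForm a (InfLam.bohmSystem (InfLam.fragileTotal a)) (tr α) := by
  obtain ⟨t, h, ht⟩ := InfLam.exists_red_isNormalForm s
  obtain ⟨α, tr, pos, h0, rfl, hc⟩ := h.exists_mConverges
  exact ⟨α, tr, pos, h0, hc, ht⟩
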